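/- Let $\alpha,\beta,\delta\in\mathbb R$ with $\delta\ne 0$, and let $q,\Delta:[0,\frac{\pi}{2})\cup(\frac{\pi}{2},\pi]\to\mathbb R$ be continuous with finite one-sided limits at $\frac{\pi}{2}$, such that $\Delta\ge 0$, $x-\Delta(x)\ge 0$ for $x\in[0,\frac{\pi}{2})$, and $x-\Delta(x)\ge\frac{\pi}{2}$ for $x\in(\frac{\pi}{2},\pi]$. Consider, with a real spectral parameter $\lambda$, the boundary value problem $$y''(x)+q(x)\,y(x-\Delta(x))+\lambda y(x)=0,\qquad x\in[0,\tfrac{\pi}{2})\cup(\tfrac{\pi}{2},\pi], \tag{1}$$ $$y(0)\cos\alpha+y'(0)\sin\alpha=0, \tag{2}$$ $$y(\pi)\cos\beta+y'(\pi)\sin\beta=0, \tag{3}$$ $$y(\tfrac{\pi}{2}-0)-\sqrt[3]{\lambda}\,\delta\,y(\tfrac{\pi}{2}+0)=0, \tag{4}$$ $$y'(\tfrac{\pi}{2}-0)-\sqrt[3]{\lambda}\,\delta\,y'(\tfrac{\pi}{2}+0)=0, \tag{5}$$ where the one-sided limits in (4) and (5) are required to exist, and where, if $x>\frac{\pi}{2}$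 and $x-\Delta(x)=\frac{\pi}{2}$, the value $y(x-\Delta(x))$ in (1) is $y(\frac{\pi}{2}+0)$. An eigenvalue is a real $\lambda$ for which there is a real solution $y$ of (1)–(5) that is not identically zero; such a $y$ is an eigenfunction. Assume that $\sin\alpha\ne 0$ and $\sin\beta\ne 0$. (i) For every $\varepsilon\in(0,1)$ there is $N$ such that for every natural number $n\ge N$ there is exactly one eigenvalue $\lambda>0$ with $|\sqrt{\lambda}-n|<\varepsilon$. (ii) For large $n$ let $\lambda_n=s_n^2$, $s_n>0$, be the eigenvalue with $|s_n-n|<\frac12$. Then $s_n=n+O(n^{-1/3})$ as $n\to\infty$. (iii) For all large $n$ there is an eigenfunction $u_n$ for $\lambda_n$ with $u_n(0)=\sin\alpha$ and $u_n'(0)=-\cos\alpha$, every eigenfunction for $\lambda_n$ is a nonzero constant multiple of $u_n$, and, as $n\to\infty$, uniformly in $x$, $$u_n(x)=\sin\alpha\cos nx+O(n^{-1/3}),\quad x\in[0,\tfrac{\pi}{2}),\qquad u_n(x)=\frac{\sin\alpha}{\delta n^{2/3}}\cos nx+O(n^{-1}),\quad x\in(\tfrac{\pi}{2},\pi].$$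 -/

import Mathlib

open Filter Topology

namespace RetardedBVP

/-- The interval `[0, π]` without the point of discontinuity: `[0, π/2) ∪ (π/2, π]`. -/
def dom : Set ℝ := Set.Ico 0 (Real.pi / 2) ∪ Set.Ioc (Real.pi / 2) Real.pi

/-- The real cube root of a real number (odd in `x`). -/
noncomputable def cbrt (x : ℝ) : ℝ := Real.sign x * |x| ^ (1 / 3 : ℝ)

/-- The derivative of a function on `[0, π/2) ∪ (π/2, π]`, one-sided at `0` and at `π`. -/
noncomputable def D (y : ℝ → ℝ) : ℝ → ℝ := derivWithin y dom

/-- The standing assumptions on the potential `q` and the retardation `Δ`. -/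
structure Admissible (q Δ : ℝ → ℝ) : Prop where
  q_cont : ContinuousOn q dom
  q_left : ∃ a, Tendsto q (𝓝[<] (Real.pi / 2)) (𝓝 a)
  q_right : ∃ a, Tendsto q (𝓝[>] (Real.pi / 2)) (𝓝 a)
  delay_cont : ContinuousOn Δ dom
  delay_left : ∃ a, Tendsto Δ (𝓝[<] (Real.pi / 2)) (𝓝 a)
  delay_right : ∃ a, Tendsto Δ (𝓝[>] (Real.pi / 2)) (𝓝 a)
  delay_nonneg : ∀ x ∈ dom, 0 ≤ Δ x
  arg_left : ∀ x ∈ Set.Ico 0 (Real.pi / 2), 0 ≤ x - Δ x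
  arg_right : ∀ x ∈ Set.Ioc (Real.pi / 2) Real.pi, Real.pi / 2 ≤ x - Δ x

/-- `y` solves `y''(x) + q(x) y(x - Δ(x)) + lam y(x) = 0` on `[0, π/2) ∪ (π/2, π]`.
The retarded argument can equal `π/2` only for some `x > π/2`; the value of `y` there is
`y(π/2 + 0)`. -/
structure IsSolution (q Δ : ℝ → ℝ) (lam : ℝ) (y : ℝ → ℝ) : Prop where
  diff : DifferentiableOn ℝ y dom
  diff_two : DifferentiableOn ℝ (D y) dom
  right_value : Tendsto y (𝓝[>] (Real.pi / 2)) (𝓝 (y (Real.pi / 2)))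
  equation : ∀ x ∈ dom, D (D y) x + q x * y (x - Δ x) + lam * y x = 0

/-- `f(π/2 - 0)` and `f(π/2 + 0)` exist, and `f(π/2 - 0) - κ f(π/2 + 0) = 0`. -/
def Transmission (κ : ℝ) (f : ℝ → ℝ) : Prop :=
  ∃ a b : ℝ, Tendsto f (𝓝[<] (Real.pi / 2)) (𝓝 a) ∧
    Tendsto f (𝓝[>] (Real.pi / 2)) (𝓝 b) ∧ a - κ * b = 0

/-- `y` is an eigenfunction of the boundary value problem for the (real) parameter `lam`. -/
structure IsEigenfunction (q Δ : ℝ → ℝ) (α β δ lam : ℝ) (y : ℝ → ℝ) : Prop where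
  solution : IsSolution q Δ lam y
  boundary_zero : y 0 * Real.cos α + D y 0 * Real.sin α = 0
  boundary_pi : y Real.pi * Real.cos β + D y Real.pi * Real.sin β = 0
  transmission : Transmission (cbrt lam * δ) y
  transmission_deriv : Transmission (cbrt lam * δ) (D y)
  nontrivial : ∃ x ∈ dom, y x ≠ 0

/-- `lam` is an eigenvalue of the boundary value problem. -/
def IsEigenvalue (q Δ : ℝ → ℝ) (α β δ lam : ℝ) : Prop :=
  ∃ y, IsEigenfunction q Δ α β δ lam y

end RetardedBVP

/-!
The point `π/2` splits the interval into two halves. By the sign conditions on the delay, the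
retarded argument never leaves the half it starts in, so each half carries its own retarded
initial value problem; shifted to `[0, π/2]`, both have the form
`f'' = -p f(τ) - s² f` with `0 ≤ τ(x) ≤ x`, where `λ = s²`. The transmission conditions only say
that the initial data on the right half are the final data of the left half divided by
`κ = s^(2/3) δ`.

Variation of constants (`IsHalfSolution.eq_add_duhamel`) gives
`f x = f 0 cos (s x) + (f' 0 / s) sin (s x) - (1 / s) ∫ sin (s (x - t)) p(t) f(τ t) dt`,
and the same formula with a phase shift of `π/2` gives `f' / s`. For large `s` the integral term
is a contraction in the supremum norm. This yields existence (`HalfCoeff.exists_solution`),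
uniqueness (`IsHalfSolution.eqOn_smul`), a uniform bound (`IsHalfSolution.abs_le`) and
Lipschitz dependence on `s` (`IsHalfSolution.abs_sub_le`), all without Gronwall's inequality.

Hence the solution starting from `(sin α, -cos α)` is `sin α cos (s x) + O(1/s)` on the left, and
`κ` times it is `sin α cos (s x) + O(1/s)` on the right (`Shooting.exists_bound`). Any
eigenfunction is a multiple of this solution, so the eigenvalues are determined by the boundary
condition at `π`, which becomes `sin (π s) = R(s) / s` with `R` bounded and Lipschitz for large `s`
(`exists_isEigenvalue_sq_iff`). Near an integer `n` the left side is monotone with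
slope bounded away from zero while the right side has Lipschitz constant `O(1/n)`; the intermediate
value theorem gives a root, the Lipschitz bound its uniqueness (`BddLip.existsUnique_sin_eq`), and its
distance from `n` is `O(1/n)` (`BddLip.exists_abs_sub_nat_le`), which is stronger than the required
`O(n^(-1/3))`.
-/

namespace RetardedBVP

open Set

/-! ### The retarded equation on one half interval -/

section

/-- Coefficients of the retarded equation on `[0, L]`: a potential `p` bounded by `K` and a retarded
argument `τ` with `0 ≤ τ t ≤ t`. Both are taken continuous on the whole line, but only their values
on `[0, L]` matter. -/
structure HalfCoeff (L K : ℝ) (p τ : ℝ → ℝ) : Prop where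
  cont_p : Continuous p
  cont_arg : Continuous τ
  bound : ∀ t ∈ Icc 0 L, |p t| ≤ K
  arg_nonneg : ∀ t ∈ Icc 0 L, 0 ≤ τ t
  arg_le : ∀ t ∈ Icc 0 L, τ t ≤ t

/-- `f` solves `f'' = -p f(τ) - s² f` on `(0, L)` with derivative `g`, and `f` and `g` extend
continuously to the end points. No differentiability is required at `0` and `L`, so that the
one-sided limits of an eigenfunction at `π/2` fit the definition. -/
structure IsHalfSolution (L : ℝ) (p τ : ℝ → ℝ) (s : ℝ) (f g : ℝ → ℝ) : Prop where
  cont : ContinuousOn f (Icc 0 L)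
  cont_deriv : ContinuousOn g (Icc 0 L)
  hasDerivAt : ∀ x ∈ Ioo 0 L, HasDerivAt f (g x) x
  hasDerivAt_deriv : ∀ x ∈ Ioo 0 L, HasDerivAt g (-(p x * f (τ x)) - s ^ 2 * f x) x

/-- The integral term of the variation of constants formula,
`∫₀ˣ sin (s (x - t) + φ) p(t) f(τ t) dt`.
The phase `φ = 0` belongs to `f` and `φ = π/2` to `f' / s`. -/
noncomputable def duhamel (p τ : ℝ → ℝ) (s φ x : ℝ) (f : ℝ → ℝ) : ℝ :=
  ∫ t in (0 : ℝ)..x, Real.sin (s * (x - t) + φ) * (p t * f (τ t))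

variable {L K s s₁ s₂ : ℝ} {p τ f g f₁ g₁ f₂ g₂ : ℝ → ℝ}

lemma HalfCoeff.mapsTo (h : HalfCoeff L K p τ) : MapsTo τ (Icc 0 L) (Icc 0 L) :=
  fun t ht => ⟨h.arg_nonneg t ht, (h.arg_le t ht).trans ht.2⟩

lemma HalfCoeff.continuousOn_integrand (h : HalfCoeff L K p τ) (hf : ContinuousOn f (Icc 0 L))
    (s φ x : ℝ) :
    ContinuousOn (fun t => Real.sin (s * (x - t) + φ) * (p t * f (τ t))) (Icc 0 L) := by
  have h1 : ContinuousOn (fun t => f (τ t)) (Icc 0 L) :=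
    hf.comp h.cont_arg.continuousOn h.mapsTo
  have h2 : Continuous fun t => Real.sin (s * (x - t) + φ) := by fun_prop
  exact h2.continuousOn.mul (h.cont_p.continuousOn.mul h1)

lemma HalfCoeff.intervalIntegrable (h : HalfCoeff L K p τ) (hf : ContinuousOn f (Icc 0 L))
    (s φ : ℝ) {x : ℝ} (hx : x ∈ Icc 0 L) :
    IntervalIntegrable (fun t => Real.sin (s * (x - t) + φ) * (p t * f (τ t)))
      MeasureTheory.volume 0 x := by
  apply ContinuousOn.intervalIntegrable
  rw [uIcc_of_le hx.1]
  exact (h.continuousOn_integrand hf s φ x).mono (Icc_subset_Icc_right hx.2)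

/-- Variation of constants, for `f` and its derivative at once through the phase `φ`: the function
`t ↦ f t cos θ + (g t / s) sin θ` with `θ = s (x - t) + φ` has derivative
`-(1 / s) sin θ · p(t) f(τ t)`. -/
lemma IsHalfSolution.eq_add_duhamel (h : HalfCoeff L K p τ) (hf : IsHalfSolution L p τ s f g)
    (hs : s ≠ 0) (φ : ℝ) {x : ℝ} (hx : x ∈ Icc 0 L) :
    f x * Real.cos φ + g x / s * Real.sin φ =
      f 0 * Real.cos (s * x + φ) + g 0 / s * Real.sin (s * x + φ)
        - s⁻¹ * duhamel p τ s φ x f := by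
  have hsub : Icc 0 x ⊆ Icc 0 L := Icc_subset_Icc_right hx.2
  have key := intervalIntegral.integral_eq_sub_of_hasDerivAt_of_le hx.1
    (f := fun t => f t * Real.cos (s * (x - t) + φ) + g t / s * Real.sin (s * (x - t) + φ))
    (f' := fun t => -s⁻¹ * (Real.sin (s * (x - t) + φ) * (p t * f (τ t)))) ?_ ?_
    ((h.intervalIntegrable hf.cont s φ hx).const_mul _)
  · rw [intervalIntegral.integral_const_mul] at key
    simp only [sub_self, mul_zero, zero_add, sub_zero] at key
    rw [duhamel]
    linarith
  · have h1 := hf.cont.mono hsub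
    have h2 := hf.cont_deriv.mono hsub
    have h3 : Continuous fun t => Real.sin (s * (x - t) + φ) := by fun_prop
    have h4 : Continuous fun t => Real.cos (s * (x - t) + φ) := by fun_prop
    exact (h1.mul h4.continuousOn).add ((h2.div_const s).mul h3.continuousOn)
  · intro t ht
    have ht' : t ∈ Ioo 0 L := ⟨ht.1, ht.2.trans_le hx.2⟩
    have hθ : HasDerivAt (fun t => s * (x - t) + φ) (-s) t := by
      simpa using (((hasDerivAt_id t).const_sub x).const_mul s).add_const φ
    refine (((hf.hasDerivAt t ht').mul hθ.cos).add
      (((hf.hasDerivAt_deriv t ht').div_const s).mul hθ.sin)).congr_deriv ?_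
    field_simp
    ring

lemma HalfCoeff.abs_duhamel_le (h : HalfCoeff L K p τ) {M : ℝ}
    (hM : ∀ x ∈ Icc 0 L, |f x| ≤ M) (s φ : ℝ) {x : ℝ} (hx : x ∈ Icc 0 L) :
    |duhamel p τ s φ x f| ≤ K * L * M := by
  have h0 : (0 : ℝ) ∈ Icc 0 L := ⟨le_rfl, hx.1.trans hx.2⟩
  have hK : 0 ≤ K := (abs_nonneg _).trans (h.bound 0 h0)
  have hM0 : 0 ≤ M := (abs_nonneg _).trans (hM 0 h0)
  have := intervalIntegral.norm_integral_le_of_norm_le_const (a := 0) (b := x) (C := K * M)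
    (f := fun t => Real.sin (s * (x - t) + φ) * (p t * f (τ t))) ?_
  · rw [Real.norm_eq_abs, sub_zero, abs_of_nonneg hx.1] at this
    calc _ ≤ K * M * x := this
      _ ≤ K * M * L := by gcongr; exact hx.2
      _ = _ := by ring
  · intro t ht
    rw [uIoc_of_le hx.1] at ht
    have ht' : t ∈ Icc 0 L := ⟨ht.1.le, ht.2.trans hx.2⟩
    rw [Real.norm_eq_abs, abs_mul, abs_mul]
    calc _ ≤ 1 * (K * M) := by
          gcongr
          · exact Real.abs_sin_le_one _
          · exact h.bound t ht'
          · exact hM _ (h.mapsTo ht')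
      _ = _ := one_mul _

lemma abs_sin_sub_sin_le (x y : ℝ) : |Real.sin x - Real.sin y| ≤ |x - y| := by
  simpa [Real.dist_eq] using Real.lipschitzWith_sin.dist_le_mul x y

lemma abs_cos_sub_cos_le (x y : ℝ) : |Real.cos x - Real.cos y| ≤ |x - y| := by
  simpa [Real.dist_eq] using Real.lipschitzWith_cos.dist_le_mul x y

lemma HalfCoeff.abs_duhamel_sub_le (h : HalfCoeff L K p τ) {M E : ℝ}
    (hf₁ : ContinuousOn f₁ (Icc 0 L)) (hf₂ : ContinuousOn f₂ (Icc 0 L))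
    (hM : ∀ x ∈ Icc 0 L, |f₁ x| ≤ M) (hE : ∀ x ∈ Icc 0 L, |f₁ x - f₂ x| ≤ E)
    (s₁ s₂ φ : ℝ) {x : ℝ} (hx : x ∈ Icc 0 L) :
    |duhamel p τ s₁ φ x f₁ - duhamel p τ s₂ φ x f₂| ≤ K * L * (L * |s₁ - s₂| * M + E) := by
  have h0 : (0 : ℝ) ∈ Icc 0 L := ⟨le_rfl, hx.1.trans hx.2⟩
  have hL : 0 ≤ L := h0.2
  have hK : 0 ≤ K := (abs_nonneg _).trans (h.bound 0 h0)
  have hM0 : 0 ≤ M := (abs_nonneg _).trans (hM 0 h0)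
  have hE0 : 0 ≤ E := (abs_nonneg _).trans (hE 0 h0)
  rw [duhamel, duhamel, ← intervalIntegral.integral_sub (h.intervalIntegrable hf₁ s₁ φ hx)
    (h.intervalIntegrable hf₂ s₂ φ hx)]
  have := intervalIntegral.norm_integral_le_of_norm_le_const (a := 0) (b := x)
    (C := K * (L * |s₁ - s₂| * M + E))
    (f := fun t => Real.sin (s₁ * (x - t) + φ) * (p t * f₁ (τ t))
      - Real.sin (s₂ * (x - t) + φ) * (p t * f₂ (τ t))) ?_
  · rw [Real.norm_eq_abs, sub_zero, abs_of_nonneg hx.1] at this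
    calc _ ≤ K * (L * |s₁ - s₂| * M + E) * x := this
      _ ≤ K * (L * |s₁ - s₂| * M + E) * L := by gcongr; exact hx.2
      _ = _ := by ring
  · intro t ht
    rw [uIoc_of_le hx.1] at ht
    have ht' : t ∈ Icc 0 L := ⟨ht.1.le, ht.2.trans hx.2⟩
    have e : Real.sin (s₁ * (x - t) + φ) * (p t * f₁ (τ t))
      - Real.sin (s₂ * (x - t) + φ) * (p t * f₂ (τ t)) =
      p t * ((Real.sin (s₁ * (x - t) + φ) - Real.sin (s₂ * (x - t) + φ)) * f₁ (τ t)
        + Real.sin (s₂ * (x - t) + φ) * (f₁ (τ t) - f₂ (τ t))) := by ring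
    rw [Real.norm_eq_abs, e, abs_mul]
    have h1 : |Real.sin (s₁ * (x - t) + φ) - Real.sin (s₂ * (x - t) + φ)| ≤ L * |s₁ - s₂| := by
      refine (abs_sin_sub_sin_le _ _).trans ?_
      rw [show s₁ * (x - t) + φ - (s₂ * (x - t) + φ) = (x - t) * (s₁ - s₂) by ring, abs_mul,
        abs_of_nonneg (by linarith [ht.2])]
      gcongr
      linarith [ht.1, hx.2]
    gcongr
    · exact h.bound t ht'
    · refine (abs_add_le _ _).trans ?_
      rw [abs_mul, abs_mul]
      have h3 : |f₁ (τ t) - f₂ (τ t)| ≤ E := hE _ (h.mapsTo ht')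
      gcongr
      · exact hM _ (h.mapsTo ht')
      · calc _ ≤ 1 * E := by
              gcongr
              exact Real.abs_sin_le_one _
          _ = E := one_mul E

lemma exists_isMax_abs (hL : 0 ≤ L) (hf : ContinuousOn f (Icc 0 L)) :
    ∃ x ∈ Icc 0 L, ∀ y ∈ Icc 0 L, |f y| ≤ |f x| := by
  obtain ⟨x, hx, h⟩ := isCompact_Icc.exists_isMaxOn (nonempty_Icc.2 hL) hf.abs
  exact ⟨x, hx, fun y hy => h hy⟩

lemma abs_mul_cos_add_mul_sin_le (a b θ : ℝ) :
    |a * Real.cos θ + b * Real.sin θ| ≤ |a| + |b| := by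
  refine (abs_add_le _ _).trans ?_
  rw [abs_mul, abs_mul]
  gcongr
  · exact mul_le_of_le_one_right (abs_nonneg _) (Real.abs_cos_le_one _)
  · exact mul_le_of_le_one_right (abs_nonneg _) (Real.abs_sin_le_one _)

lemma IsHalfSolution.eq_of_zero_phase (h : HalfCoeff L K p τ) (hf : IsHalfSolution L p τ s f g)
    (hs : s ≠ 0) {x : ℝ} (hx : x ∈ Icc 0 L) :
    f x = f 0 * Real.cos (s * x) + g 0 / s * Real.sin (s * x) - s⁻¹ * duhamel p τ s 0 x f := by
  simpa using hf.eq_add_duhamel h hs 0 hx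

lemma IsHalfSolution.deriv_eq (h : HalfCoeff L K p τ) (hf : IsHalfSolution L p τ s f g)
    (hs : s ≠ 0) {x : ℝ} (hx : x ∈ Icc 0 L) :
    g x / s = -(f 0 * Real.sin (s * x)) + g 0 / s * Real.cos (s * x)
      - s⁻¹ * duhamel p τ s (Real.pi / 2) x f := by
  simpa [Real.cos_add_pi_div_two, Real.sin_add_pi_div_two] using
    hf.eq_add_duhamel h hs (Real.pi / 2) hx

lemma HalfCoeff.nonneg (h : HalfCoeff L K p τ) (hL : 0 ≤ L) : 0 ≤ K :=
  (abs_nonneg _).trans (h.bound 0 ⟨le_rfl, hL⟩)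

/-- A solution is at most twice the size of its data, since at a maximum point of `|f|` the integral
term is at most half the maximum. -/
lemma IsHalfSolution.abs_le (h : HalfCoeff L K p τ) (hL : 0 ≤ L)
    (hf : IsHalfSolution L p τ s f g) (hs : 1 ≤ s) (hs' : 4 * (K * L) ≤ s) {A : ℝ}
    (hA : |f 0| + |g 0 / s| ≤ A) : ∀ x ∈ Icc 0 L, |f x| ≤ 2 * A := by
  obtain ⟨x, hx, hmax⟩ := exists_isMax_abs hL hf.cont
  have hs0 : 0 < s := by linarith
  have h1 := h.abs_duhamel_le hmax s 0 hx
  have h2 := abs_mul_cos_add_mul_sin_le (f 0) (g 0 / s) (s * x)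
  have h3 : |s⁻¹ * duhamel p τ s 0 x f| ≤ |f x| / 2 := by
    rw [abs_mul, abs_of_pos (inv_pos.2 hs0), inv_mul_le_iff₀ hs0]
    nlinarith [abs_nonneg (f x)]
  have h4 : |f x| ≤ A + |f x| / 2 := by
    conv_lhs => rw [hf.eq_of_zero_phase h hs0.ne' hx]
    refine (abs_sub _ _).trans ?_
    linarith
  intro y hy
  linarith [hmax y hy]

lemma IsHalfSolution.abs_duhamel_le (h : HalfCoeff L K p τ) (hL : 0 ≤ L)
    (hf : IsHalfSolution L p τ s f g) (hs : 1 ≤ s) (hs' : 4 * (K * L) ≤ s) {A : ℝ}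
    (hA : |f 0| + |g 0 / s| ≤ A) (φ : ℝ) : ∀ x ∈ Icc 0 L,
      |duhamel p τ s φ x f| ≤ K * L * (2 * A) :=
  fun _ hx => h.abs_duhamel_le (hf.abs_le h hL hs hs' hA) s φ hx

/-- Lipschitz dependence of the solution on its data and on the frequency `s`. -/
lemma IsHalfSolution.abs_sub_le (h : HalfCoeff L K p τ) (hL : 0 ≤ L)
    (hf₁ : IsHalfSolution L p τ s₁ f₁ g₁) (hf₂ : IsHalfSolution L p τ s₂ f₂ g₂)
    (hs₁ : 1 ≤ s₁) (hs₁' : 4 * (K * L) ≤ s₁) (hs₂ : 1 ≤ s₂) (hs₂' : 4 * (K * L) ≤ s₂) {A : ℝ}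
    (hA₁ : |f₁ 0| + |g₁ 0 / s₁| ≤ A) (hA₂ : |f₂ 0| + |g₂ 0 / s₂| ≤ A) :
    ∀ x ∈ Icc 0 L, |f₁ x - f₂ x| ≤ 2 * (|f₁ 0 - f₂ 0| + |g₁ 0 / s₁ - g₂ 0 / s₂|)
      + 4 * (L * A + K * L * A) * |s₁ - s₂| := by
  have hK := h.nonneg hL
  have h₁pos : 0 < s₁ := by linarith
  have h₂pos : 0 < s₂ := by linarith
  obtain ⟨x, hx, hmax⟩ := exists_isMax_abs hL (hf₁.cont.sub hf₂.cont)
  simp only [Pi.sub_apply] at hmax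
  have hA0 : 0 ≤ A := le_trans (by positivity) hA₁
  have hb := h.abs_duhamel_sub_le hf₁.cont hf₂.cont (hf₁.abs_le h hL hs₁ hs₁' hA₁) hmax s₁ s₂ 0 hx
  have hI := hf₂.abs_duhamel_le h hL hs₂ hs₂' hA₂ 0 x hx
  set I₁ := duhamel p τ s₁ 0 x f₁
  set I₂ := duhamel p τ s₂ 0 x f₂
  set E := |f₁ x - f₂ x| with hE
  set d := |s₁ - s₂|
  have hd : 0 ≤ d := abs_nonneg _
  have hE0 : 0 ≤ E := abs_nonneg _
  have hxd : |s₁ * x - s₂ * x| ≤ L * d := by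
    rw [← sub_mul, abs_mul, abs_of_nonneg hx.1, mul_comm]
    gcongr
    exact hx.2
  have hc := (abs_cos_sub_cos_le (s₁ * x) (s₂ * x)).trans hxd
  have hsn := (abs_sin_sub_sin_le (s₁ * x) (s₂ * x)).trans hxd
  have t1 : |s₁⁻¹ * (I₁ - I₂)| ≤ L * d * A + E / 2 := by
    rw [abs_mul, abs_of_pos (inv_pos.2 h₁pos), inv_mul_le_iff₀ h₁pos]
    have : 0 ≤ L * d * A := by positivity
    nlinarith
  have t2 : |(s₁⁻¹ - s₂⁻¹) * I₂| ≤ 2 * (K * L * A) * d := by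
    have e : s₁⁻¹ - s₂⁻¹ = -(s₁ - s₂) * (s₁⁻¹ * s₂⁻¹) := by
      field_simp
      ring
    have i1 : s₁⁻¹ ≤ 1 := inv_le_one_of_one_le₀ hs₁
    have i2 : s₂⁻¹ ≤ 1 := inv_le_one_of_one_le₀ hs₂
    rw [abs_mul, e, abs_mul, abs_neg, abs_of_nonneg (by positivity : 0 ≤ s₁⁻¹ * s₂⁻¹)]
    calc d * (s₁⁻¹ * s₂⁻¹) * |I₂| ≤ d * (1 * 1) * (K * L * (2 * A)) := by gcongr
      _ = _ := by ring
  have t3 := abs_mul_cos_add_mul_sin_le (f₁ 0 - f₂ 0) (g₁ 0 / s₁ - g₂ 0 / s₂) (s₁ * x)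
  have t4 : |f₂ 0 * (Real.cos (s₁ * x) - Real.cos (s₂ * x))
      + g₂ 0 / s₂ * (Real.sin (s₁ * x) - Real.sin (s₂ * x))| ≤ A * (L * d) := by
    refine (abs_add_le _ _).trans ?_
    rw [abs_mul, abs_mul]
    calc _ ≤ |f₂ 0| * (L * d) + |g₂ 0 / s₂| * (L * d) := by gcongr
      _ = (|f₂ 0| + |g₂ 0 / s₂|) * (L * d) := by ring
      _ ≤ _ := by gcongr
  have hE' : E ≤ (|f₁ 0 - f₂ 0| + |g₁ 0 / s₁ - g₂ 0 / s₂|) + A * (L * d)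
      + (L * d * A + E / 2) + 2 * (K * L * A) * d := by
    have e : f₁ x - f₂ x =
      ((f₁ 0 - f₂ 0) * Real.cos (s₁ * x) + (g₁ 0 / s₁ - g₂ 0 / s₂) * Real.sin (s₁ * x))
      + (f₂ 0 * (Real.cos (s₁ * x) - Real.cos (s₂ * x))
      + g₂ 0 / s₂ * (Real.sin (s₁ * x) - Real.sin (s₂ * x)))
      - (s₁⁻¹ * (I₁ - I₂)) - (s₁⁻¹ - s₂⁻¹) * I₂ := by
      rw [hf₁.eq_of_zero_phase h h₁pos.ne' hx, hf₂.eq_of_zero_phase h h₂pos.ne' hx]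
      ring
    conv_lhs => rw [hE, e]
    refine (abs_sub _ _).trans (add_le_add ((abs_sub _ _).trans (add_le_add
      ((abs_add_le _ _).trans (add_le_add t3 t4)) t1)) t2)
  intro y hy
  have := hmax y hy
  nlinarith

/-- Uniqueness for the initial value problem: proportional data give proportional solutions. -/
lemma IsHalfSolution.eqOn_smul (h : HalfCoeff L K p τ) (hL : 0 ≤ L)
    (hf₁ : IsHalfSolution L p τ s f₁ g₁) (hf₂ : IsHalfSolution L p τ s f₂ g₂)
    (hs : 1 ≤ s) (hs' : 4 * (K * L) ≤ s) {c : ℝ}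
    (h0 : f₁ 0 = c * f₂ 0) (h1 : g₁ 0 = c * g₂ 0) {x : ℝ} (hx : x ∈ Icc 0 L) :
    f₁ x = c * f₂ x ∧ g₁ x = c * g₂ x := by
  have hsol : IsHalfSolution L p τ s (fun x => f₁ x - c * f₂ x) (fun x => g₁ x - c * g₂ x) := by
    refine ⟨hf₁.cont.sub (hf₂.cont.const_mul c), hf₁.cont_deriv.sub (hf₂.cont_deriv.const_mul c),
      fun x hx => (hf₁.hasDerivAt x hx).sub ((hf₂.hasDerivAt x hx).const_mul c),
      fun x hx => ((hf₁.hasDerivAt_deriv x hx).sub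
        ((hf₂.hasDerivAt_deriv x hx).const_mul c)).congr_deriv (by ring)⟩
  have hz : |f₁ 0 - c * f₂ 0| + |(g₁ 0 - c * g₂ 0) / s| ≤ 0 := by simp [h0, h1]
  have hs0 : s ≠ 0 := by linarith
  have e1 := hsol.abs_le h hL hs hs' hz x hx
  have e2 := hsol.abs_duhamel_le h hL hs hs' hz (Real.pi / 2) x hx
  have e3 := hsol.deriv_eq h hs0 hx
  simp only [mul_zero, abs_nonpos_iff] at e1 e2
  simp only [h0, h1, e2, sub_self, zero_div, zero_mul, mul_zero, neg_zero, add_zero,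
    div_eq_zero_iff, hs0, or_false] at e3
  constructor <;> linarith

/-- Existence for large `s`, by the contraction principle on `C([0, L])`. The solution is
differentiable in the two-sided sense at the end points as well. -/
lemma HalfCoeff.exists_solution (h : HalfCoeff L K p τ) (hL : 0 ≤ L) (hs : 1 ≤ s)
    (hs' : 4 * (K * L) ≤ s) (a b : ℝ) : ∃ f g : ℝ → ℝ, f 0 = a ∧ g 0 = b ∧
      (∀ x ∈ Icc 0 L, HasDerivAt f (g x) x) ∧
      ∀ x ∈ Icc 0 L, HasDerivAt g (-(p x * f (τ x)) - s ^ 2 * f x) x := by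
  have hK := h.nonneg hL
  have hs0 : 0 < s := by linarith
  -- `F v` solves `F'' = -s² F - r v` with the given data, where the forcing `r v` comes from `v`,
  -- and `G v` is its derivative; a fixed point of `v ↦ F v` solves the retarded equation
  let r : C(Icc 0 L, ℝ) → ℝ → ℝ := fun v t => p t * IccExtend hL v (τ t)
  have hr : ∀ v, Continuous (r v) := fun v =>
    h.cont_p.mul (v.continuous.Icc_extend'.comp h.cont_arg)
  let P : C(Icc 0 L, ℝ) → ℝ → ℝ := fun v x => ∫ t in (0 : ℝ)..x, Real.cos (s * t) * r v t
  let Q : C(Icc 0 L, ℝ) → ℝ → ℝ := fun v x => ∫ t in (0 : ℝ)..x, Real.sin (s * t) * r v t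
  have hP : ∀ v x, HasDerivAt (P v) (Real.cos (s * x) * r v x) x := fun v x =>
    Continuous.integral_hasStrictDerivAt
      ((by fun_prop : Continuous fun t => Real.cos (s * t)).mul (hr v)) 0 x |>.hasDerivAt
  have hQ : ∀ v x, HasDerivAt (Q v) (Real.sin (s * x) * r v x) x := fun v x =>
    Continuous.integral_hasStrictDerivAt
      ((by fun_prop : Continuous fun t => Real.sin (s * t)).mul (hr v)) 0 x |>.hasDerivAt
  let F : C(Icc 0 L, ℝ) → ℝ → ℝ := fun v x => (a - -s⁻¹ * Q v x) * Real.cos (s * x)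
    + (b / s - s⁻¹ * P v x) * Real.sin (s * x)
  let G : C(Icc 0 L, ℝ) → ℝ → ℝ := fun v x => s * (-((a - -s⁻¹ * Q v x) * Real.sin (s * x))
    + (b / s - s⁻¹ * P v x) * Real.cos (s * x))
  have hθ : ∀ x, HasDerivAt (fun x => s * x) s x := fun x => by
    simpa using (hasDerivAt_id x).const_mul s
  have hF : ∀ v x, HasDerivAt (F v) (G v x) x := fun v x => by
    refine (((((hQ v x).const_mul (-s⁻¹)).const_sub a).mul (hθ x).cos).add
      ((((hP v x).const_mul s⁻¹).const_sub (b / s)).mul (hθ x).sin)).congr_deriv ?_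
    simp only [G]
    ring
  have hG : ∀ v x, HasDerivAt (G v) (-(r v x) - s ^ 2 * F v x) x := fun v x => by
    refine ((((((hQ v x).const_mul (-s⁻¹)).const_sub a).mul (hθ x).sin).neg.add
      ((((hP v x).const_mul s⁻¹).const_sub (b / s)).mul (hθ x).cos)).const_mul s).congr_deriv ?_
    simp only [F]
    have := Real.sin_sq_add_cos_sq (s * x)
    field_simp
    linear_combination (-(r v x)) * this
  let T : C(Icc 0 L, ℝ) → C(Icc 0 L, ℝ) := fun v =>
    ⟨fun x => F v x, (continuous_iff_continuousAt.2 fun x => (hF v x).continuousAt).comp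
      continuous_subtype_val⟩
  have hPQ : ∀ (v w : C(Icc 0 L, ℝ)) (c : ℝ → ℝ), Continuous c → (∀ t, |c t| ≤ 1) →
      ∀ x ∈ Icc 0 L, |(∫ t in (0 : ℝ)..x, c t * r v t) - ∫ t in (0 : ℝ)..x, c t * r w t|
        ≤ K * L * dist v w := by
    intro v w c hc hc1 x hx
    have hi : ∀ u, IntervalIntegrable (fun t => c t * r u t) MeasureTheory.volume 0 x := fun u =>
      (hc.mul (hr u)).intervalIntegrable _ _
    rw [← intervalIntegral.integral_sub (hi v) (hi w)]
    have := intervalIntegral.norm_integral_le_of_norm_le_const (a := 0) (b := x)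
      (C := K * dist v w) (f := fun t => c t * r v t - c t * r w t) ?_
    · rw [Real.norm_eq_abs, sub_zero, abs_of_nonneg hx.1] at this
      calc _ ≤ K * dist v w * x := this
        _ ≤ K * dist v w * L := by gcongr; exact hx.2
        _ = _ := by ring
    · intro t ht
      rw [uIoc_of_le hx.1] at ht
      have ht' : t ∈ Icc 0 L := ⟨ht.1.le, ht.2.trans hx.2⟩
      have e : c t * r v t - c t * r w t = c t * (p t *
        (IccExtend hL v (τ t) - IccExtend hL w (τ t))) := by simp only [r]; ring
      rw [Real.norm_eq_abs, e, abs_mul, abs_mul]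
      calc _ ≤ 1 * (K * dist v w) := by
            gcongr
            · exact hc1 t
            · exact h.bound t ht'
            · exact ContinuousMap.dist_apply_le_dist (f := v) (g := w) _
        _ = _ := one_mul _
  have hT : ContractingWith (1 / 2) T := by
    refine ⟨by
      rw [← NNReal.coe_lt_coe]
      norm_num, LipschitzWith.of_dist_le_mul fun v w => ?_⟩
    rw [ContinuousMap.dist_le (by positivity)]
    rintro ⟨x, hx⟩
    have h1 := hPQ v w (fun t => Real.cos (s * t)) (by fun_prop)
      (fun t => Real.abs_cos_le_one _) x hx
    have h2 := hPQ v w (fun t => Real.sin (s * t)) (by fun_prop)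
      (fun t => Real.abs_sin_le_one _) x hx
    change |P v x - P w x| ≤ _ at h1
    change |Q v x - Q w x| ≤ _ at h2
    change dist (F v x) (F w x) ≤ _
    have e : F v x - F w x = s⁻¹ * ((Q v x - Q w x) * Real.cos (s * x)
      + (-(P v x - P w x)) * Real.sin (s * x)) := by simp only [F]; ring
    rw [Real.dist_eq, e, abs_mul, abs_of_pos (inv_pos.2 hs0), inv_mul_le_iff₀ hs0]
    refine (abs_mul_cos_add_mul_sin_le _ _ _).trans ?_
    rw [abs_neg]
    push_cast
    nlinarith [dist_nonneg (x := v) (y := w)]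
  let v := hT.fixedPoint T
  have hv : T v = v := hT.fixedPoint_isFixedPt
  refine ⟨F v, G v, ?_, ?_, fun x _ => hF v x, fun x hx => ?_⟩
  · simp [F, Q]
  · simp only [G, P, Q, intervalIntegral.integral_same, mul_zero, Real.sin_zero, Real.cos_zero]
    field_simp
    ring
  · have e : r v x = p x * F v (τ x) := by
      simp only [r]
      rw [IccExtend_of_mem hL v (h.mapsTo hx)]
      conv_lhs => rw [← hv]
      rfl
    rw [← e]
    exact hG v x

end

/-! ### Bounded Lipschitz functions of the frequency, and perturbations of `sin (π s) = 0` -/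

section

/-- `h` is bounded and Lipschitz on `[S, ∞)`, with a common constant. -/
def BddLip (S : ℝ) (h : ℝ → ℝ) : Prop :=
  ∃ B, ∀ s, S ≤ s → |h s| ≤ B ∧ ∀ t, S ≤ t → |h s - h t| ≤ B * |s - t|

namespace BddLip
variable {S : ℝ} {h k : ℝ → ℝ}

lemma const (S c : ℝ) : BddLip S fun _ => c :=
  ⟨|c|, fun s _ => ⟨le_rfl, fun t _ => by simp; positivity⟩⟩

lemma add (hh : BddLip S h) (hk : BddLip S k) : BddLip S fun s => h s + k s := by
  obtain ⟨B, hB⟩ := hh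
  obtain ⟨B', hB'⟩ := hk
  refine ⟨B + B', fun s hs => ⟨(abs_add_le _ _).trans (add_le_add (hB s hs).1 (hB' s hs).1),
    fun t ht => ?_⟩⟩
  have e : h s + k s - (h t + k t) = (h s - h t) + (k s - k t) := by ring
  rw [e, add_mul]
  exact (abs_add_le _ _).trans (add_le_add ((hB s hs).2 t ht) ((hB' s hs).2 t ht))

lemma mul (hh : BddLip S h) (hk : BddLip S k) : BddLip S fun s => h s * k s := by
  obtain ⟨B, hB⟩ := hh
  obtain ⟨B', hB'⟩ := hk
  have b0 : 0 ≤ B := (abs_nonneg _).trans (hB S le_rfl).1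
  have b0' : 0 ≤ B' := (abs_nonneg _).trans (hB' S le_rfl).1
  refine ⟨2 * (B * B'), fun s hs => ⟨?_, fun t ht => ?_⟩⟩
  · rw [abs_mul]
    have := mul_le_mul (hB s hs).1 (hB' s hs).1 (abs_nonneg _) b0
    nlinarith
  · have e : h s * k s - h t * k t = h s * (k s - k t) + (h s - h t) * k t := by ring
    rw [e]
    refine (abs_add_le _ _).trans ?_
    rw [abs_mul, abs_mul]
    have h1 := mul_le_mul (hB s hs).1 ((hB' s hs).2 t ht) (abs_nonneg _) b0
    have h2 := mul_le_mul ((hB s hs).2 t ht) (hB' t ht).1 (abs_nonneg _) (by positivity)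
    linarith

lemma const_mul (c : ℝ) (hh : BddLip S h) : BddLip S fun s => c * h s := (const S c).mul hh

lemma neg (hh : BddLip S h) : BddLip S fun s => -h s := by
  simpa using hh.const_mul (-1)

lemma sub (hh : BddLip S h) (hk : BddLip S k) : BddLip S fun s => h s - k s := by
  simpa [sub_eq_add_neg] using hh.add hk.neg

lemma sin_mul (S c : ℝ) : BddLip S fun s => Real.sin (s * c) := by
  refine ⟨1 + |c|, fun s _ => ⟨(Real.abs_sin_le_one _).trans (by simp), fun t _ => ?_⟩⟩
  refine (abs_sin_sub_sin_le _ _).trans ?_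
  rw [← sub_mul, abs_mul, mul_comm]
  gcongr
  simp

lemma cos_mul (S c : ℝ) : BddLip S fun s => Real.cos (s * c) := by
  refine ⟨1 + |c|, fun s _ => ⟨(Real.abs_cos_le_one _).trans (by simp), fun t _ => ?_⟩⟩
  refine (abs_cos_sub_cos_le _ _).trans ?_
  rw [← sub_mul, abs_mul, mul_comm]
  gcongr
  simp

lemma inv (hS : 1 ≤ S) : BddLip S fun s => s⁻¹ := by
  refine ⟨1, fun s hs => ?_⟩
  have hs0 : 0 < s := by linarith
  have i1 : s⁻¹ ≤ 1 := inv_le_one_of_one_le₀ (hS.trans hs)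
  refine ⟨by rwa [abs_of_pos (inv_pos.2 hs0)], fun t ht => ?_⟩
  have ht0 : 0 < t := by linarith
  have i2 : t⁻¹ ≤ 1 := inv_le_one_of_one_le₀ (hS.trans ht)
  have e : s⁻¹ - t⁻¹ = (s⁻¹ * t⁻¹) * -(s - t) := by
    field_simp
    ring
  rw [e, abs_mul, abs_neg, abs_of_pos (by positivity)]
  gcongr
  exact mul_le_one₀ i1 (by positivity) i2

lemma congr (hh : BddLip S h) (e : ∀ s, S ≤ s → k s = h s) : BddLip S k := by
  obtain ⟨B, hB⟩ := hh
  refine ⟨B, fun s hs => ?_⟩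
  rw [e s hs]
  exact ⟨(hB s hs).1, fun t ht => by rw [e t ht]; exact (hB s hs).2 t ht⟩

lemma continuousOn (hh : BddLip S h) : ContinuousOn h (Ici S) := by
  obtain ⟨B, hB⟩ := hh
  have b0 : 0 ≤ B := (abs_nonneg _).trans (hB S le_rfl).1
  refine (LipschitzOnWith.of_dist_le_mul (K := ⟨B, b0⟩) fun s hs t ht => ?_).continuousOn
  exact (hB s hs).2 t ht

end BddLip

lemma two_mul_abs_le_abs_sin {t : ℝ} (ht : |t| ≤ 1 / 2) : 2 * |t| ≤ |Real.sin (Real.pi * t)| := by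
  have hπ := Real.pi_pos
  have h := Real.mul_le_sin (x := Real.pi * |t|) (by positivity) (by nlinarith)
  have e : 2 / Real.pi * (Real.pi * |t|) = 2 * |t| := by field_simp
  rw [e] at h
  refine h.trans ?_
  rcases abs_cases t with ⟨h1, _⟩ | ⟨h1, _⟩ <;> rw [h1]
  · exact le_abs_self _
  · rw [mul_neg, Real.sin_neg]
    exact neg_le_abs _

lemma two_mul_one_sub_abs_le_abs_sin {t : ℝ} (ht : 1 / 2 ≤ |t|) (ht' : |t| ≤ 1) :
    2 * (1 - |t|) ≤ |Real.sin (Real.pi * t)| := by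
  have h := two_mul_abs_le_abs_sin (t := 1 - |t|) (by
    rw [abs_of_nonneg (by linarith)]
    linarith)
  rw [abs_of_nonneg (by linarith : 0 ≤ 1 - |t|), mul_sub Real.pi, mul_one, Real.sin_pi_sub] at h
  refine h.trans ?_
  rcases abs_cases t with ⟨h1, _⟩ | ⟨h1, _⟩ <;> rw [h1]
  rw [mul_neg, Real.sin_neg, abs_neg]

/-- On `[-1/4, 1/4]` the map `t ↦ sin (π t)` does not decrease distances. -/
lemma abs_sub_le_abs_sin_sub_sin {t u : ℝ} (ht : |t| ≤ 1 / 4) (hu : |u| ≤ 1 / 4) :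
    |t - u| ≤ |Real.sin (Real.pi * t) - Real.sin (Real.pi * u)| := by
  rw [abs_le] at ht hu
  have hπ := Real.pi_pos
  have h1 := two_mul_abs_le_abs_sin (t := (t - u) / 2) (by rw [abs_le]; constructor <;> linarith)
  have h2 : 1 / 2 ≤ Real.cos (Real.pi * ((t + u) / 2)) := by
    rw [← Real.cos_pi_div_three, ← Real.cos_abs (Real.pi * _)]
    apply Real.cos_le_cos_of_nonneg_of_le_pi (abs_nonneg _) (by linarith)
    rw [abs_le]
    constructor <;> nlinarith
  rw [Real.sin_sub_sin, abs_mul, abs_mul]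
  rw [show (Real.pi * t - Real.pi * u) / 2 = Real.pi * ((t - u) / 2) by ring,
    show (Real.pi * t + Real.pi * u) / 2 = Real.pi * ((t + u) / 2) by ring,
    abs_of_nonneg (by linarith : 0 ≤ Real.cos (Real.pi * ((t + u) / 2)))]
  rw [abs_div, abs_two] at h1
  rw [abs_two]
  nlinarith [abs_nonneg (t - u)]

lemma sin_pi_mul (n : ℕ) (s : ℝ) :
    Real.sin (Real.pi * s) = (-1) ^ n * Real.sin (Real.pi * (s - n)) := by
  rw [← Real.sin_add_nat_mul_pi]
  congr 1
  ring

lemma abs_sin_pi_mul (n : ℕ) (s : ℝ) :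
    |Real.sin (Real.pi * s)| = |Real.sin (Real.pi * (s - n))| := by
  rw [sin_pi_mul n s, abs_mul, abs_pow, abs_neg, abs_one, one_pow, one_mul]

/-- Roots of `sin (π s) = R(s) / s` in `(n - 1/2, n + 1/2)` are within `O(1/n)` of `n`. -/
lemma BddLip.exists_abs_sub_nat_le {S : ℝ} {R : ℝ → ℝ} (hS : 1 ≤ S) (hR : BddLip S R) :
    ∃ B, 0 ≤ B ∧ ∀ n : ℕ, 1 ≤ n → ∀ s, S ≤ s → |s - n| < 1 / 2 →
      Real.sin (Real.pi * s) = R s / s → |s - n| ≤ B / n := by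
  obtain ⟨B, hB⟩ := hR
  have b0 : 0 ≤ B := (abs_nonneg _).trans (hB S le_rfl).1
  refine ⟨B, b0, fun n hn s hs hsn he => ?_⟩
  have hn' : (1 : ℝ) ≤ n := by exact_mod_cast hn
  have h1 := two_mul_abs_le_abs_sin hsn.le
  rw [← abs_sin_pi_mul, he, abs_div, abs_of_pos (by linarith : 0 < s)] at h1
  have h2 : n / 2 ≤ s := by
    rw [abs_lt] at hsn
    linarith
  have h3 : |R s| / s ≤ B / (n / 2) := by
    gcongr
    exact (hB s hs).1
  have e : B / ((n : ℝ) / 2) = 2 * (B / n) := by field_simp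
  linarith

/-- For large `n` the equation `sin (π s) = R(s) / s` has exactly one root within `ε < 1` of `n`. -/
lemma BddLip.existsUnique_sin_eq {S : ℝ} {R : ℝ → ℝ} (hS : 1 ≤ S) (hR : BddLip S R)
    {ε : ℝ} (hε : 0 < ε) (hε1 : ε < 1) :
    ∃ N : ℕ, ∀ n : ℕ, N ≤ n → ∃! s, S ≤ s ∧ |s - n| < ε ∧
      Real.sin (Real.pi * s) = R s / s := by
  have hcont := hR.continuousOn
  obtain ⟨B, hB⟩ := hR
  have b0 : 0 ≤ B := (abs_nonneg _).trans (hB S le_rfl).1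
  have hεε : 0 < ε * (1 - ε) := mul_pos hε (by linarith)
  refine ⟨⌈1 + S + (4 * B + 1) / (ε * (1 - ε))⌉₊, fun n hn => ?_⟩
  rw [Nat.ceil_le] at hn
  set m : ℝ := n - 1 with hm
  -- `m` bounds from below every `s` within `ε` of `n`; the choice of `N` makes `B / m` small
  -- compared with `ε`, `1 - ε` and `1`
  have hdiv : 0 ≤ (4 * B + 1) / (ε * (1 - ε)) := by positivity
  have hmS : S ≤ m := by linarith
  have hm0 : 0 < m := by linarith
  have hmε : 4 * B + 1 ≤ m * (ε * (1 - ε)) := by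
    rw [← div_le_iff₀ hεε]
    linarith
  have hm1 : 4 * B + 1 ≤ m * ε := hmε.trans (by gcongr; nlinarith)
  have hm2 : 4 * B + 1 ≤ m * (1 - ε) := hmε.trans (by gcongr; nlinarith)
  have hm3 : 4 * B + 1 ≤ m := hm1.trans (by nlinarith)
  have hle : ∀ s, m ≤ s → |R s / s| ≤ B / m := fun s hs => by
    rw [abs_div, abs_of_pos (by linarith : 0 < s)]
    gcongr
    exact (hB s (hmS.trans hs)).1
  have hge : ∀ s : ℝ, |s - n| < ε → m ≤ s := fun s hs => by
    rw [abs_lt] at hs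
    linarith
  -- roots of the equation lie close to `n`
  have hnear : ∀ s : ℝ, |s - n| < ε → Real.sin (Real.pi * s) = R s / s → |s - n| ≤ 1 / 4 := by
    intro s hs he
    have h1 := hle s (hge s hs)
    rw [← he, abs_sin_pi_mul n] at h1
    rcases le_total |s - n| (1 / 2) with h2 | h2
    · have h3 := (two_mul_abs_le_abs_sin h2).trans h1
      rw [le_div_iff₀ hm0] at h3
      nlinarith
    · have h3 := (two_mul_one_sub_abs_le_abs_sin h2 (by linarith)).trans h1
      rw [le_div_iff₀ hm0] at h3
      nlinarith
  -- `(-1) ^ n` times the equation changes sign between `n - η` and `n + η`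
  set η := ε / 4 with hη
  have hη0 : 0 < η := by linarith
  have hsinη : B / m < Real.sin (Real.pi * η) := by
    have h := two_mul_abs_le_abs_sin (t := η) (by rw [abs_of_pos hη0]; linarith)
    rw [abs_of_pos hη0, abs_of_nonneg (Real.sin_nonneg_of_nonneg_of_le_pi (by positivity)
      (by nlinarith [Real.pi_pos]))] at h
    refine lt_of_lt_of_le ?_ h
    rw [div_lt_iff₀ hm0]
    nlinarith
  have hsgn : ∀ x : ℝ, |(-1 : ℝ) ^ n * x| = |x| := fun x => by
    rw [abs_mul, abs_pow, abs_neg, abs_one, one_pow, one_mul]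
  have hsq : (-1 : ℝ) ^ n * (-1) ^ n = 1 := by rw [← mul_pow]; norm_num
  have hend : ∀ u : ℝ, (-1) ^ n * Real.sin (Real.pi * (n + u)) = Real.sin (Real.pi * u) :=
    fun u => by rw [sin_pi_mul n, ← mul_assoc, hsq, one_mul, add_sub_cancel_left]
  have hivt : (0 : ℝ) ∈ (fun s => (-1) ^ n * (Real.sin (Real.pi * s) - R s / s)) ''
      Icc (n - η) (n + η) := by
    apply intermediate_value_Icc (by linarith)
    · refine ContinuousOn.mul continuousOn_const (ContinuousOn.sub (by fun_prop)
        (ContinuousOn.div (hcont.mono fun s hs => ?_) continuousOn_id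
          fun s hs => ne_of_gt (?_ : 0 < s)))
      · exact hmS.trans (by linarith [hs.1])
      · have := hs.1
        linarith
    · simp only [mul_sub ((-1 : ℝ) ^ n), hend, sub_eq_add_neg (n : ℝ) η]
      rw [mul_neg Real.pi, Real.sin_neg]
      constructor
      · have := (neg_abs_le _).trans' (neg_le_neg ((hsgn _).trans_le (hle (n + -η) (by linarith))))
        linarith
      · have := (le_abs_self _).trans ((hsgn _).trans_le (hle (n + η) (by linarith)))
        linarith
  obtain ⟨s, hs, he⟩ := hivt
  have he' : Real.sin (Real.pi * s) = R s / s := by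
    have : (-1 : ℝ) ^ n ≠ 0 := by positivity
    simpa [sub_eq_zero] using he
  have hsε : |s - n| < ε := by
    rw [abs_lt]
    constructor <;> linarith [hs.1, hs.2]
  refine ⟨s, ⟨hmS.trans (hge s hsε), hsε, he'⟩, ?_⟩
  rintro t ⟨_, htε, het⟩
  -- two roots contradict the Lipschitz constant `2 * B / m < 1` of the right side
  by_contra hne
  have hpos : 0 < |t - s| := abs_pos.2 (sub_ne_zero.2 hne)
  have h1 := abs_sub_le_abs_sin_sub_sin (hnear t htε het) (hnear s hsε he')
  rw [sub_sub_sub_cancel_right, ← hsgn (Real.sin _ - _), mul_sub, ← sin_pi_mul,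
    ← sin_pi_mul, het, he'] at h1
  have hs0 : m ≤ s := hge s hsε
  have ht0 : m ≤ t := hge t htε
  have e : R t / t - R s / s = (R t - R s) / t + R s / s * ((s - t) / t) := by
    have : s ≠ 0 := by linarith
    have : t ≠ 0 := by linarith
    field_simp
    ring
  have h2 : |(R t - R s) / t| ≤ B * |t - s| / m := by
    rw [abs_div, abs_of_pos (by linarith : 0 < t)]
    gcongr
    exact (hB t (hmS.trans ht0)).2 s (hmS.trans hs0)
  have h3 : |R s / s * ((s - t) / t)| ≤ B * |t - s| / m := by
    rw [abs_mul, abs_div (s - t), abs_of_pos (by linarith : 0 < t), abs_sub_comm s t]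
    calc _ ≤ B / m * (|t - s| / 1) := by
          gcongr
          · exact div_nonneg (abs_nonneg _) (by linarith)
          · exact hle s hs0
          · linarith
      _ = _ := by ring
  rw [e] at h1
  have h4 := h1.trans ((abs_add_le _ _).trans (add_le_add h2 h3))
  rw [← add_div, le_div_iff₀ hm0] at h4
  nlinarith

variable {S L K : ℝ} {p τ : ℝ → ℝ} {f g : ℝ → ℝ → ℝ}

/-- If the data of a family of solutions are bounded and Lipschitz in `s`, so is the integral term. -/
lemma BddLip.duhamel (h : HalfCoeff L K p τ) (hL : 0 ≤ L) (hS : 1 ≤ S) (hS' : 4 * (K * L) ≤ S)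
    (hsol : ∀ s, S ≤ s → IsHalfSolution L p τ s (f s) (g s))
    (h0 : BddLip S fun s => f s 0) (h1 : BddLip S fun s => g s 0 / s) (φ : ℝ) :
    BddLip S fun s => duhamel p τ s φ L (f s) := by
  have hK := h.nonneg hL
  obtain ⟨B, hB⟩ := h0
  obtain ⟨B', hB'⟩ := h1
  have b0 : 0 ≤ B := (abs_nonneg _).trans (hB S le_rfl).1
  have b0' : 0 ≤ B' := (abs_nonneg _).trans (hB' S le_rfl).1
  set A := B + B' with hA
  have hA0 : 0 ≤ A := by positivity
  have hdata : ∀ s, S ≤ s → |f s 0| + |g s 0 / s| ≤ A := fun s hs =>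
    add_le_add (hB s hs).1 (hB' s hs).1
  have hLmem : L ∈ Icc 0 L := ⟨hL, le_rfl⟩
  refine ⟨K * L * (2 * A) + K * L * (L * (2 * A) + (2 * A + 4 * (L * A + K * L * A))),
    fun s hs => ⟨?_, fun t ht => ?_⟩⟩
  · refine ((hsol s hs).abs_duhamel_le h hL (hS.trans hs) (hS'.trans hs) (hdata s hs) φ L
      hLmem).trans ?_
    have : 0 ≤ K * L * (L * (2 * A) + (2 * A + 4 * (L * A + K * L * A))) := by positivity
    linarith
  · have hsub := (hsol s hs).abs_sub_le h hL (hsol t ht) (hS.trans hs) (hS'.trans hs)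
      (hS.trans ht) (hS'.trans ht) (hdata s hs) (hdata t ht)
    have hE : ∀ x ∈ Icc 0 L, |f s x - f t x| ≤
        (2 * A + 4 * (L * A + K * L * A)) * |s - t| := fun x hx => by
      have := hsub x hx
      have h2 := (hB s hs).2 t ht
      have h3 := (hB' s hs).2 t ht
      nlinarith
    refine (h.abs_duhamel_sub_le (hsol s hs).cont (hsol t ht).cont
      ((hsol s hs).abs_le h hL (hS.trans hs) (hS'.trans hs) (hdata s hs)) hE s t φ hLmem).trans ?_
    have : 0 ≤ K * L * (2 * A) * |s - t| := by positivity
    nlinarith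

/-- The scaled data `f L` and `f' L / s` at the right end inherit boundedness and the Lipschitz
property in `s` from the data at `0`. -/
lemma BddLip.solution_right (h : HalfCoeff L K p τ) (hL : 0 ≤ L) (hS : 1 ≤ S)
    (hS' : 4 * (K * L) ≤ S) (hsol : ∀ s, S ≤ s → IsHalfSolution L p τ s (f s) (g s))
    (h0 : BddLip S fun s => f s 0) (h1 : BddLip S fun s => g s 0 / s) :
    BddLip S (fun s => f s L) ∧ BddLip S fun s => g s L / s := by
  have hLmem : L ∈ Icc 0 L := ⟨hL, le_rfl⟩
  have hd := BddLip.duhamel h hL hS hS' hsol h0 h1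
  constructor
  · refine BddLip.congr (((h0.mul (.cos_mul S L)).add (h1.mul (.sin_mul S L))).sub
      ((BddLip.inv hS).mul (hd 0))) fun s hs => ?_
    exact (hsol s hs).eq_of_zero_phase h (by linarith) hLmem
  · refine BddLip.congr (((h0.mul (.sin_mul S L)).neg.add (h1.mul (.cos_mul S L))).sub
      ((BddLip.inv hS).mul (hd (Real.pi / 2)))) fun s hs => ?_
    exact (hsol s hs).deriv_eq h (by linarith) hLmem

end

/-! ### Eigenfunctions and the two half-interval problems -/

section

/-- Coefficients `p, τ` on the left and `p', τ'` on the right half interval, both parametrized by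
`[0, π/2]`, that represent `q` and `x - Δ(x)`. The equations leave out the point `π/2`, where the
coefficients are the one-sided limits. -/
structure HalfData (q Δ : ℝ → ℝ) (K : ℝ) (p τ p' τ' : ℝ → ℝ) : Prop where
  left : HalfCoeff (Real.pi / 2) K p τ
  right : HalfCoeff (Real.pi / 2) K p' τ'
  left_coeff : ∀ x ∈ Ico 0 (Real.pi / 2), p x = q x
  left_arg : ∀ x ∈ Ico 0 (Real.pi / 2), τ x = x - Δ x
  right_coeff : ∀ t ∈ Ioc 0 (Real.pi / 2), p' t = q (Real.pi / 2 + t)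
  right_arg : ∀ t ∈ Ioc 0 (Real.pi / 2),
    Real.pi / 2 + τ' t = Real.pi / 2 + t - Δ (Real.pi / 2 + t)

variable {q Δ y φ : ℝ → ℝ}

lemma mem_dom_left {x : ℝ} (hx : x ∈ Ico 0 (Real.pi / 2)) : x ∈ dom := Or.inl hx

lemma mem_dom_right {t : ℝ} (ht : t ∈ Ioc 0 (Real.pi / 2)) : Real.pi / 2 + t ∈ dom :=
  Or.inr ⟨by linarith [ht.1], by linarith [ht.2]⟩

lemma continuousOn_update_left {a : ℝ} (hφ : ContinuousOn φ dom)
    (ha : Tendsto φ (𝓝[<] (Real.pi / 2)) (𝓝 a)) :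
    ContinuousOn (Function.update φ (Real.pi / 2) a) (Icc 0 (Real.pi / 2)) := by
  rw [continuousOn_update_iff, Icc_sdiff_right]
  exact ⟨hφ.mono fun x hx => mem_dom_left hx,
    fun _ => ha.mono_left (nhdsWithin_mono _ fun x hx => hx.2)⟩

lemma continuousOn_update_right {b : ℝ} (hφ : ContinuousOn φ dom)
    (hb : Tendsto φ (𝓝[>] (Real.pi / 2)) (𝓝 b)) :
    ContinuousOn (fun t => Function.update φ (Real.pi / 2) b (Real.pi / 2 + t))
      (Icc 0 (Real.pi / 2)) := by
  have h : ContinuousOn (Function.update φ (Real.pi / 2) b) (Icc (Real.pi / 2) Real.pi) := by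
    rw [continuousOn_update_iff, Icc_sdiff_left]
    exact ⟨hφ.mono fun x hx => Or.inr hx,
      fun _ => hb.mono_left (nhdsWithin_mono _ fun x hx => hx.1)⟩
  exact h.comp (by fun_prop) fun t ht => ⟨by linarith [ht.1], by linarith [ht.2]⟩

lemma exists_continuous_eqOn {L : ℝ} (hL : 0 ≤ L) (hφ : ContinuousOn φ (Icc 0 L)) :
    ∃ ψ : ℝ → ℝ, Continuous ψ ∧ EqOn ψ φ (Icc 0 L) :=
  ⟨IccExtend hL ((Icc 0 L).domRestrict φ), (continuousOn_iff_continuous_domRestrict.1 hφ).Icc_extend',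
    fun x hx => by rw [IccExtend_of_mem hL _ hx]; rfl⟩

lemma Admissible.exists_halfData (h : Admissible q Δ) :
    ∃ K p τ p' τ', HalfData q Δ K p τ p' τ' := by
  have hL : (0 : ℝ) < Real.pi / 2 := by positivity
  obtain ⟨a, ha⟩ := h.q_left
  obtain ⟨b, hb⟩ := h.q_right
  obtain ⟨a', ha'⟩ := h.delay_left
  obtain ⟨b', hb'⟩ := h.delay_right
  obtain ⟨p, hp, hpe⟩ := exists_continuous_eqOn hL.le (continuousOn_update_left h.q_cont ha)
  obtain ⟨p', hp', hpe'⟩ := exists_continuous_eqOn hL.le (continuousOn_update_right h.q_cont hb)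
  obtain ⟨d, hd, hde⟩ := exists_continuous_eqOn hL.le (continuousOn_update_left h.delay_cont ha')
  obtain ⟨d', hd', hde'⟩ :=
    exists_continuous_eqOn hL.le (continuousOn_update_right h.delay_cont hb')
  have hd1 : ∀ x ∈ Ico 0 (Real.pi / 2), d x = Δ x := fun x hx => by
    rw [hde (Ico_subset_Icc_self hx), Function.update_of_ne hx.2.ne]
  have hd1' : ∀ t ∈ Ioc 0 (Real.pi / 2), d' t = Δ (Real.pi / 2 + t) := fun t ht => by
    rw [hde' (Ioc_subset_Icc_self ht)]
    exact Function.update_of_ne (by linarith [ht.1]) _ _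
  -- the bounds on the delay pass to the limit at `π/2`
  have hclos : ∀ x ∈ Icc 0 (Real.pi / 2), 0 ≤ d x ∧ d x ≤ x := by
    have hcl : IsClosed {x : ℝ | 0 ≤ d x ∧ d x ≤ x} :=
      (isClosed_le continuous_const hd).inter (isClosed_le hd continuous_id)
    rw [← closure_Ico hL.ne]
    refine fun x hx => closure_minimal (fun x hx => ?_) hcl hx
    rw [mem_ofPred_eq, hd1 x hx]
    exact ⟨h.delay_nonneg x (mem_dom_left hx), by linarith [h.arg_left x hx]⟩
  have hclos' : ∀ x ∈ Icc 0 (Real.pi / 2), 0 ≤ d' x ∧ d' x ≤ x := by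
    have hcl : IsClosed {x : ℝ | 0 ≤ d' x ∧ d' x ≤ x} :=
      (isClosed_le continuous_const hd').inter (isClosed_le hd' continuous_id)
    rw [← closure_Ioc hL.ne]
    refine fun x hx => closure_minimal (fun x hx => ?_) hcl hx
    rw [mem_ofPred_eq, hd1' x hx]
    have hx' := mem_dom_right hx
    have := h.arg_right (Real.pi / 2 + x) ⟨by linarith [hx.1], by linarith [hx.2]⟩
    exact ⟨h.delay_nonneg _ hx', by linarith⟩
  obtain ⟨K₁, hK₁⟩ := isCompact_Icc.exists_bound_of_continuousOn
    (hp.continuousOn (s := Icc 0 (Real.pi / 2)))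
  obtain ⟨K₂, hK₂⟩ := isCompact_Icc.exists_bound_of_continuousOn
    (hp'.continuousOn (s := Icc 0 (Real.pi / 2)))
  refine ⟨max K₁ K₂, p, fun x => x - d x, p', fun x => x - d' x,
    ⟨hp, by fun_prop, fun t ht => (hK₁ t ht).trans (le_max_left _ _), fun t ht => ?_,
      fun t ht => ?_⟩,
    ⟨hp', by fun_prop, fun t ht => (hK₂ t ht).trans (le_max_right _ _), fun t ht => ?_,
      fun t ht => ?_⟩, fun x hx => ?_, fun x hx => ?_, fun t ht => ?_, fun t ht => ?_⟩
  · linarith [(hclos t ht).2]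
  · linarith [(hclos t ht).1]
  · linarith [(hclos' t ht).2]
  · linarith [(hclos' t ht).1]
  · rw [hpe (Ico_subset_Icc_self hx), Function.update_of_ne hx.2.ne]
  · rw [hd1 x hx]
  · rw [hpe' (Ioc_subset_Icc_self ht)]
    exact Function.update_of_ne (by linarith [ht.1]) _ _
  · rw [hd1' t ht]
    ring

lemma dom_mem_nhds_left {x : ℝ} (hx : x ∈ Ioo 0 (Real.pi / 2)) : dom ∈ 𝓝 x :=
  mem_of_superset (Ioo_mem_nhds hx.1 hx.2) fun _ h => mem_dom_left (Ioo_subset_Ico_self h)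

lemma dom_mem_nhds_right {t : ℝ} (ht : t ∈ Ioo 0 (Real.pi / 2)) : dom ∈ 𝓝 (Real.pi / 2 + t) :=
  mem_of_superset (Ioo_mem_nhds (a := Real.pi / 2) (b := Real.pi) (by linarith [ht.1])
    (by linarith [ht.2])) fun _ h => Or.inr (Ioo_subset_Ioc_self h)

lemma hasDerivAt_D {x : ℝ} (hφ : DifferentiableOn ℝ φ dom) (hx : dom ∈ 𝓝 x) :
    HasDerivAt φ (D φ x) x :=
  (hφ x (mem_of_mem_nhds hx)).hasDerivWithinAt.hasDerivAt hx

lemma hasDerivAt_update {x c a φ' : ℝ} (hφ : HasDerivAt φ φ' x) (hx : x ≠ c) :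
    HasDerivAt (Function.update φ c a) φ' x :=
  hφ.congr_of_eventuallyEq <|
    (eventually_ne_nhds hx).mono fun _ hz => Function.update_of_ne hz _ _

variable {K s : ℝ} {p τ p' τ' : ℝ → ℝ} {a a' b' : ℝ}

lemma IsSolution.left (hd : HalfData q Δ K p τ p' τ') (hy : IsSolution q Δ (s ^ 2) y)
    (ha : Tendsto y (𝓝[<] (Real.pi / 2)) (𝓝 a))
    (ha' : Tendsto (D y) (𝓝[<] (Real.pi / 2)) (𝓝 a')) :
    IsHalfSolution (Real.pi / 2) p τ s (Function.update y (Real.pi / 2) a)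
      (Function.update (D y) (Real.pi / 2) a') := by
  refine ⟨continuousOn_update_left hy.diff.continuousOn ha,
    continuousOn_update_left hy.diff_two.continuousOn ha', fun x hx => ?_, fun x hx => ?_⟩
  · rw [Function.update_of_ne hx.2.ne]
    exact hasDerivAt_update (hasDerivAt_D hy.diff (dom_mem_nhds_left hx)) hx.2.ne
  · have hx' := Ioo_subset_Ico_self hx
    have h := hasDerivAt_update (a := a') (hasDerivAt_D hy.diff_two (dom_mem_nhds_left hx)) hx.2.ne
    refine h.congr_deriv ?_
    have hτ : τ x ≠ Real.pi / 2 :=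
      ((hd.left.arg_le x (Ioo_subset_Icc_self hx)).trans_lt hx.2).ne
    rw [Function.update_of_ne hx.2.ne, Function.update_of_ne hτ, hd.left_coeff x hx',
      hd.left_arg x hx']
    linarith [hy.equation x (mem_dom_left hx')]

lemma IsSolution.right (hd : HalfData q Δ K p τ p' τ') (hy : IsSolution q Δ (s ^ 2) y)
    (hb' : Tendsto (D y) (𝓝[>] (Real.pi / 2)) (𝓝 b')) :
    IsHalfSolution (Real.pi / 2) p' τ' s (fun t => y (Real.pi / 2 + t))
      (fun t => Function.update (D y) (Real.pi / 2) b' (Real.pi / 2 + t)) := by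
  refine ⟨?_, continuousOn_update_right hy.diff_two.continuousOn hb', fun t ht => ?_,
    fun t ht => ?_⟩
  · simpa using continuousOn_update_right hy.diff.continuousOn hy.right_value
  · have hne : Real.pi / 2 + t ≠ Real.pi / 2 := by linarith [ht.1]
    rw [Function.update_of_ne hne]
    exact (hasDerivAt_D hy.diff (dom_mem_nhds_right ht)).comp_const_add _ _
  · have hne : Real.pi / 2 + t ≠ Real.pi / 2 := by linarith [ht.1]
    have ht' := Ioo_subset_Ioc_self ht
    have h := (hasDerivAt_update (a := b') (hasDerivAt_D hy.diff_two (dom_mem_nhds_right ht))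
      hne).comp_const_add _ _
    refine h.congr_deriv ?_
    rw [hd.right_coeff t ht', hd.right_arg t ht']
    linarith [hy.equation _ (mem_dom_right ht')]

/-- `f` (with derivative `g`) solves the left problem with data `(sin α, -cos α)`, and `z` (with
derivative `w`) solves the shifted right problem with the final data of `f`. The factor `1 / κ` of
the transmission conditions is left out: the solution on the right half is `z / κ`. -/
structure Shooting (p τ p' τ' : ℝ → ℝ) (α s : ℝ) (f g z w : ℝ → ℝ) : Prop where
  left : ∀ x ∈ Icc 0 (Real.pi / 2), HasDerivAt f (g x) x
  left_two : ∀ x ∈ Icc 0 (Real.pi / 2), HasDerivAt g (-(p x * f (τ x)) - s ^ 2 * f x) x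
  right : ∀ x ∈ Icc 0 (Real.pi / 2), HasDerivAt z (w x) x
  right_two : ∀ x ∈ Icc 0 (Real.pi / 2), HasDerivAt w (-(p' x * z (τ' x)) - s ^ 2 * z x) x
  left_value : f 0 = Real.sin α
  left_slope : g 0 = -Real.cos α
  right_value : z 0 = f (Real.pi / 2)
  right_slope : w 0 = g (Real.pi / 2)

lemma isHalfSolution_of_hasDerivAt {L : ℝ} {f g : ℝ → ℝ}
    (h1 : ∀ x ∈ Icc 0 L, HasDerivAt f (g x) x)
    (h2 : ∀ x ∈ Icc 0 L, HasDerivAt g (-(p x * f (τ x)) - s ^ 2 * f x) x) :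
    IsHalfSolution L p τ s f g :=
  ⟨fun x hx => (h1 x hx).continuousAt.continuousWithinAt,
    fun x hx => (h2 x hx).continuousAt.continuousWithinAt,
    fun x hx => h1 x (Ioo_subset_Icc_self hx), fun x hx => h2 x (Ioo_subset_Icc_self hx)⟩

variable {α β δ : ℝ} {f g z w : ℝ → ℝ}

lemma Shooting.isHalfSolution_left (h : Shooting p τ p' τ' α s f g z w) :
    IsHalfSolution (Real.pi / 2) p τ s f g := isHalfSolution_of_hasDerivAt h.left h.left_two

lemma Shooting.isHalfSolution_right (h : Shooting p τ p' τ' α s f g z w) :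
    IsHalfSolution (Real.pi / 2) p' τ' s z w := isHalfSolution_of_hasDerivAt h.right h.right_two

lemma HalfData.exists_shooting (hd : HalfData q Δ K p τ p' τ') (α : ℝ) (hs : 1 ≤ s)
    (hs' : 4 * (K * (Real.pi / 2)) ≤ s) :
    ∃ f g z w, Shooting p τ p' τ' α s f g z w := by
  have hL : (0 : ℝ) ≤ Real.pi / 2 := by positivity
  obtain ⟨f, g, h1, h2, h3, h4⟩ := hd.left.exists_solution hL hs hs' (Real.sin α) (-Real.cos α)
  obtain ⟨z, w, k1, k2, k3, k4⟩ :=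
    hd.right.exists_solution hL hs hs' (f (Real.pi / 2)) (g (Real.pi / 2))
  exact ⟨f, g, z, w, h3, h4, k3, k4, h1, h2, k1, k2⟩

lemma cbrt_sq_ne_zero (hs : 0 < s) : cbrt (s ^ 2) ≠ 0 := by
  have : 0 < s ^ 2 := by positivity
  rw [cbrt, Real.sign_of_pos this, abs_of_pos this]
  positivity

lemma cbrt_sq (hs : 0 < s) : cbrt (s ^ 2) = s ^ (2 / 3 : ℝ) := by
  have : 0 < s ^ 2 := by positivity
  rw [cbrt, Real.sign_of_pos this, abs_of_pos this, one_mul, ← Real.rpow_natCast,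
    ← Real.rpow_mul hs.le]
  norm_num

/-- Every eigenfunction is a multiple of the shooting solution, which therefore satisfies the
boundary condition at `π`. -/
lemma IsEigenfunction.eq_smul_shooting (hd : HalfData q Δ K p τ p' τ') (hδ : δ ≠ 0)
    (hα : Real.sin α ≠ 0) (hs : 1 ≤ s) (hs' : 4 * (K * (Real.pi / 2)) ≤ s)
    (hy : IsEigenfunction q Δ α β δ (s ^ 2) y) (sh : Shooting p τ p' τ' α s f g z w) :
    ∃ c, c ≠ 0 ∧ (∀ x ∈ Ico 0 (Real.pi / 2), y x = c * f x) ∧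
      (∀ t ∈ Ioc 0 (Real.pi / 2), y (Real.pi / 2 + t) = c / (cbrt (s ^ 2) * δ) * z t) ∧
      z (Real.pi / 2) * Real.cos β + w (Real.pi / 2) * Real.sin β = 0 := by
  have hL : (0 : ℝ) < Real.pi / 2 := by positivity
  have hκ : cbrt (s ^ 2) * δ ≠ 0 := mul_ne_zero (cbrt_sq_ne_zero (by linarith)) hδ
  set κ := cbrt (s ^ 2) * δ
  obtain ⟨a, b, ha, hb, hab⟩ := hy.transmission
  obtain ⟨a', b', ha', hb', hab'⟩ := hy.transmission_deriv
  obtain rfl : b = y (Real.pi / 2) := tendsto_nhds_unique hb hy.solution.right_value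
  have hl := hy.solution.left hd ha ha'
  have hr := hy.solution.right hd hb'
  have h0 : y 0 = y 0 / Real.sin α * f 0 := by
    rw [sh.left_value]
    field_simp
  have h0' : D y 0 = y 0 / Real.sin α * g 0 := by
    rw [sh.left_slope]
    field_simp
    linarith [hy.boundary_zero]
  set c := y 0 / Real.sin α
  have hleft := fun x (hx : x ∈ Icc 0 (Real.pi / 2)) =>
    hl.eqOn_smul hd.left hL.le sh.isHalfSolution_left hs hs' (c := c)
      (by rwa [Function.update_of_ne hL.ne]) (by rwa [Function.update_of_ne hL.ne]) hx
  have hend := hleft _ (right_mem_Icc.2 hL.le)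
  simp only [Function.update_self] at hend
  have hright := fun t (ht : t ∈ Icc 0 (Real.pi / 2)) =>
    hr.eqOn_smul hd.right hL.le sh.isHalfSolution_right hs hs' (c := c / κ)
      (by rw [add_zero, sh.right_value, div_mul_eq_mul_div, eq_div_iff hκ, ← hend.1]; linarith)
      (by rw [add_zero, Function.update_self, sh.right_slope, div_mul_eq_mul_div, eq_div_iff hκ,
            ← hend.2]; linarith) ht
  have hyl : ∀ x ∈ Ico 0 (Real.pi / 2), y x = c * f x := fun x hx => by
    simpa [Function.update_of_ne hx.2.ne] using (hleft x (Ico_subset_Icc_self hx)).1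
  have hyr : ∀ t ∈ Ioc 0 (Real.pi / 2), y (Real.pi / 2 + t) = c / κ * z t := fun t ht =>
    (hright t (Ioc_subset_Icc_self ht)).1
  have hc : c ≠ 0 := by
    intro hc
    -- for `c = 0` the eigenfunction would vanish on both halves
    obtain ⟨x, hx, hne⟩ := hy.nontrivial
    rcases hx with hx | hx
    · exact hne (by rw [hyl x hx, hc, zero_mul])
    · have := hyr (x - Real.pi / 2) ⟨by linarith [hx.1], by linarith [hx.2]⟩
      rw [add_sub_cancel, hc, zero_div, zero_mul] at this
      exact hne this
  refine ⟨c, hc, hyl, hyr, ?_⟩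
  obtain ⟨e1, e2⟩ := hright _ (right_mem_Icc.2 hL.le)
  rw [add_halves] at e1 e2
  rw [Function.update_of_ne (by linarith)] at e2
  have e3 := hy.boundary_pi
  rw [e1, e2] at e3
  have : c / κ * (z (Real.pi / 2) * Real.cos β + w (Real.pi / 2) * Real.sin β) = 0 := by
    linarith
  exact (mul_eq_zero.1 this).resolve_left (div_ne_zero hc hκ)

/-- The function equal to `f` on the left of `π/2` and to `h` from `π/2` on. At `π/2` it takes the
right-hand value, as the retarded argument on the right half requires. -/
noncomputable def glue (f h : ℝ → ℝ) (x : ℝ) : ℝ := if x < Real.pi / 2 then f x else h x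

lemma glue_left (f h : ℝ → ℝ) {x : ℝ} (hx : x < Real.pi / 2) : glue f h x = f x := if_pos hx

lemma glue_right (f h : ℝ → ℝ) {x : ℝ} (hx : Real.pi / 2 ≤ x) : glue f h x = h x :=
  if_neg hx.not_gt

lemma hasDerivWithinAt_glue {f f' h h' : ℝ → ℝ}
    (hf : ∀ x ∈ Ico 0 (Real.pi / 2), HasDerivAt f (f' x) x)
    (hh : ∀ x ∈ Ioc (Real.pi / 2) Real.pi, HasDerivAt h (h' x) x) {x : ℝ} (hx : x ∈ dom) :
    HasDerivWithinAt (glue f h) (glue f' h' x) dom x := by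
  apply HasDerivAt.hasDerivWithinAt
  rcases hx with hx | hx
  · rw [glue_left _ _ hx.2]
    exact (hf x hx).congr_of_eventuallyEq <|
      (eventually_lt_nhds hx.2).mono fun z hz => glue_left _ _ hz
  · rw [glue_right _ _ hx.1.le]
    exact (hh x hx).congr_of_eventuallyEq <|
      (eventually_gt_nhds hx.1).mono fun z hz => glue_right _ _ hz.le

lemma uniqueDiffOn_dom : UniqueDiffOn ℝ dom := by
  rintro x (hx | hx)
  · exact (uniqueDiffOn_Ico 0 (Real.pi / 2) x hx).mono fun _ h => Or.inl h
  · exact (uniqueDiffOn_Ioc (Real.pi / 2) Real.pi x hx).mono fun _ h => Or.inr h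

lemma tendsto_glue_left {f h u : ℝ → ℝ} (hf : ContinuousAt f (Real.pi / 2))
    (hu : EqOn u (glue f h) dom) :
    Tendsto u (𝓝[<] (Real.pi / 2)) (𝓝 (f (Real.pi / 2))) := by
  refine (hf.tendsto.mono_left nhdsWithin_le_nhds).congr' ?_
  filter_upwards [Ioo_mem_nhdsLT (show (0 : ℝ) < Real.pi / 2 by positivity)] with x hx
  rw [hu (Or.inl ⟨hx.1.le, hx.2⟩), glue_left _ _ hx.2]

lemma tendsto_glue_right {f h u : ℝ → ℝ} (hh : ContinuousAt h (Real.pi / 2))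
    (hu : EqOn u (glue f h) dom) :
    Tendsto u (𝓝[>] (Real.pi / 2)) (𝓝 (h (Real.pi / 2))) := by
  refine (hh.tendsto.mono_left nhdsWithin_le_nhds).congr' ?_
  filter_upwards [Ioo_mem_nhdsGT (show Real.pi / 2 < Real.pi by linarith [Real.pi_pos])] with x hx
  rw [hu (Or.inr ⟨hx.1, hx.2.le⟩), glue_right _ _ hx.1.le]

/-- If the shooting solution satisfies the boundary condition at `π`, it is an eigenfunction. -/
lemma Shooting.isEigenfunction (hd : HalfData q Δ K p τ p' τ') (hδ : δ ≠ 0)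
    (hα : Real.sin α ≠ 0) (hs : 0 < s) (sh : Shooting p τ p' τ' α s f g z w)
    (hchar : z (Real.pi / 2) * Real.cos β + w (Real.pi / 2) * Real.sin β = 0)
    {κ : ℝ} (hκ : κ = cbrt (s ^ 2) * δ) :
    IsEigenfunction q Δ α β δ (s ^ 2) (glue f fun x => z (x - Real.pi / 2) / κ) ∧
      D (glue f fun x => z (x - Real.pi / 2) / κ) 0 = -Real.cos α := by
  have hL : (0 : ℝ) < Real.pi / 2 := by positivity
  have hκ0 : κ ≠ 0 := hκ ▸ mul_ne_zero (cbrt_sq_ne_zero hs) hδ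
  have hmem : ∀ x ∈ Ioc (Real.pi / 2) Real.pi, x - Real.pi / 2 ∈ Ioc 0 (Real.pi / 2) :=
    fun x hx => ⟨by linarith [hx.1], by linarith [hx.2]⟩
  set u := glue f fun x => z (x - Real.pi / 2) / κ with hu
  set u₁ := glue g fun x => w (x - Real.pi / 2) / κ with hu₁
  set u₂ := glue (fun x => -(p x * f (τ x)) - s ^ 2 * f x) fun x =>
    (-(p' (x - Real.pi / 2) * z (τ' (x - Real.pi / 2))) - s ^ 2 * z (x - Real.pi / 2)) / κ
    with hu₂
  have d1 : ∀ x ∈ dom, HasDerivWithinAt u (u₁ x) dom x := fun x hx =>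
    hasDerivWithinAt_glue (fun x hx => sh.left x (Ico_subset_Icc_self hx)) (fun x hx =>
      ((sh.right _ (Ioc_subset_Icc_self (hmem x hx))).comp_sub_const x _).div_const κ) hx
  have d2 : ∀ x ∈ dom, HasDerivWithinAt u₁ (u₂ x) dom x := fun x hx =>
    hasDerivWithinAt_glue (fun x hx => sh.left_two x (Ico_subset_Icc_self hx)) (fun x hx =>
      ((sh.right_two _ (Ioc_subset_Icc_self (hmem x hx))).comp_sub_const x _).div_const κ) hx
  have hD : EqOn (D u) u₁ dom := fun x hx => (d1 x hx).derivWithin (uniqueDiffOn_dom x hx)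
  have d2' : ∀ x ∈ dom, HasDerivWithinAt (D u) (u₂ x) dom x := fun x hx =>
    (d2 x hx).congr hD (hD hx)
  have hDD : ∀ x ∈ dom, D (D u) x = u₂ x := fun x hx =>
    (d2' x hx).derivWithin (uniqueDiffOn_dom x hx)
  have hz0 : HasDerivAt z (w (Real.pi / 2 - Real.pi / 2)) (Real.pi / 2 - Real.pi / 2) := by
    rw [sub_self]
    exact sh.right 0 (left_mem_Icc.2 hL.le)
  have hw0 := sh.right_two 0 (left_mem_Icc.2 hL.le)
  rw [← sub_self (Real.pi / 2)] at hw0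
  have cz : ContinuousAt (fun x => z (x - Real.pi / 2) / κ) (Real.pi / 2) :=
    ((hz0.comp_sub_const _ _).div_const κ).continuousAt
  have cw : ContinuousAt (fun x => w (x - Real.pi / 2) / κ) (Real.pi / 2) :=
    ((hw0.comp_sub_const _ _).div_const κ).continuousAt
  have cf := (sh.left _ (right_mem_Icc.2 hL.le)).continuousAt
  have cg := (sh.left_two _ (right_mem_Icc.2 hL.le)).continuousAt
  have h0 : (0 : ℝ) ∈ dom := Or.inl ⟨le_rfl, hL⟩
  have hπ : Real.pi ∈ dom := Or.inr ⟨by linarith, le_rfl⟩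
  have v0 : u 0 = Real.sin α := by rw [hu, glue_left _ _ hL, sh.left_value]
  have v1 : D u 0 = -Real.cos α := by rw [hD h0, hu₁, glue_left _ _ hL, sh.left_slope]
  have vr : u (Real.pi / 2) = z (Real.pi / 2 - Real.pi / 2) / κ := glue_right _ _ le_rfl
  refine ⟨⟨⟨fun x hx => (d1 x hx).differentiableWithinAt,
    fun x hx => (d2' x hx).differentiableWithinAt, ?_, ?_⟩, ?_, ?_, ?_, ?_, 0, h0, ?_⟩, v1⟩
  · rw [vr]
    exact tendsto_glue_right cz fun _ _ => rfl
  · intro x hx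
    rw [hDD x hx]
    rcases hx with hx | hx
    · have hτ := hd.left_arg x hx
      have hlt : τ x < Real.pi / 2 :=
        (hd.left.arg_le x (Ico_subset_Icc_self hx)).trans_lt hx.2
      rw [← hτ, hu, hu₂, glue_left _ _ hx.2, glue_left _ _ hx.2, glue_left _ _ hlt,
        hd.left_coeff x hx]
      ring
    · have ht := hmem x hx
      have hτ := hd.right_arg _ ht
      have hp := hd.right_coeff _ ht
      have hge := hd.right.arg_nonneg _ (Ioc_subset_Icc_self ht)
      rw [add_sub_cancel] at hτ hp
      rw [← hτ, ← hp, hu, hu₂, glue_right _ _ hx.1.le, glue_right _ _ hx.1.le,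
        glue_right _ _ (by linarith), add_sub_cancel_left]
      ring
  · rw [v0, v1]
    ring
  · rw [hD hπ, hu, hu₁, glue_right _ _ (by linarith), glue_right _ _ (by linarith),
      show Real.pi - Real.pi / 2 = Real.pi / 2 by ring]
    rw [div_mul_eq_mul_div, div_mul_eq_mul_div, ← add_div, hchar, zero_div]
  · refine ⟨_, _, tendsto_glue_left cf fun _ _ => rfl, tendsto_glue_right cz fun _ _ => rfl, ?_⟩
    rw [← hκ, sub_self, sh.right_value]
    field_simp
    ring
  · refine ⟨_, _, tendsto_glue_left cg hD, tendsto_glue_right cw hD, ?_⟩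
    rw [← hκ, sub_self, sh.right_slope]
    field_simp
    ring
  · rwa [v0]

end

/-! ### Asymptotics and the characteristic equation -/

section

variable {q Δ : ℝ → ℝ} {K S : ℝ} {p τ p' τ' : ℝ → ℝ} {α β δ : ℝ}

/-- The leading terms of the shooting solution, uniformly in `s` and in the point. -/
lemma Shooting.exists_bound (hd : HalfData q Δ K p τ p' τ') (α : ℝ) :
    ∃ B, 0 ≤ B ∧ ∀ s f g z w, 1 ≤ s → 4 * (K * (Real.pi / 2)) ≤ s →
      Shooting p τ p' τ' α s f g z w →
      (∀ x ∈ Icc 0 (Real.pi / 2), |f x - Real.sin α * Real.cos (s * x)| ≤ B / s) ∧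
      ∀ t ∈ Icc 0 (Real.pi / 2),
        |z t - Real.sin α * Real.cos (s * (Real.pi / 2 + t))| ≤ B / s := by
  have hL : (0 : ℝ) ≤ Real.pi / 2 := by positivity
  have hLm := right_mem_Icc.2 hL
  have hK := hd.left.nonneg hL
  set L := Real.pi / 2
  set B₁ := 1 + K * L * (2 * 2) with hB₁
  have hB₁0 : 0 ≤ B₁ := by positivity
  set B₂ := K * L * (2 * (2 * (1 + B₁))) with hB₂
  have hB₂0 : 0 ≤ B₂ := by positivity
  refine ⟨2 * B₁ + B₂, by positivity, fun s f g z w hs hs' sh => ?_⟩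
  have hs0 : 0 < s := by linarith
  have hinv : s⁻¹ ≤ 1 := inv_le_one_of_one_le₀ hs
  have hl := sh.isHalfSolution_left
  have hr := sh.isHalfSolution_right
  have hdata : |f 0| + |g 0 / s| ≤ 2 := by
    rw [sh.left_value, sh.left_slope, abs_div, abs_neg, abs_of_pos hs0]
    have h1 := Real.abs_sin_le_one α
    have h2 : |Real.cos α| / s ≤ 1 := (div_le_one hs0).2 ((Real.abs_cos_le_one α).trans hs)
    linarith
  have hI := hl.abs_duhamel_le hd.left hL hs hs' hdata
  have haux : ∀ c I : ℝ, |c| ≤ 1 → |I| ≤ K * L * (2 * 2) →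
      |-Real.cos α / s * c - s⁻¹ * I| ≤ B₁ / s := by
    intro c I hc hI
    have e : -Real.cos α / s * c - s⁻¹ * I = (-(Real.cos α * c) - I) / s := by ring
    rw [e, abs_div, abs_of_pos hs0]
    gcongr
    refine (abs_sub _ _).trans (add_le_add ?_ hI)
    rw [abs_neg, abs_mul]
    exact mul_le_one₀ (Real.abs_cos_le_one α) (abs_nonneg _) hc
  have hf : ∀ x ∈ Icc 0 L, |f x - Real.sin α * Real.cos (s * x)| ≤ B₁ / s := fun x hx => by
    rw [hl.eq_of_zero_phase hd.left hs0.ne' hx, sh.left_value, sh.left_slope, add_sub_assoc,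
      add_sub_cancel_left]
    exact haux _ _ (Real.abs_sin_le_one _) (hI 0 x hx)
  have hg : |g L / s - -(Real.sin α * Real.sin (s * L))| ≤ B₁ / s := by
    rw [hl.deriv_eq hd.left hs0.ne' hLm, sh.left_value, sh.left_slope, add_sub_assoc,
      add_sub_cancel_left]
    exact haux _ _ (Real.abs_cos_le_one _) (hI _ L hLm)
  have hB₁s : B₁ / s ≤ B₁ := div_le_self hB₁0 hs
  have hdata' : |z 0| + |w 0 / s| ≤ 2 * (1 + B₁) := by
    rw [sh.right_value, sh.right_slope]
    have h1 : |Real.sin α * Real.cos (s * L)| ≤ 1 := by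
      rw [abs_mul]
      exact mul_le_one₀ (Real.abs_sin_le_one α) (abs_nonneg _) (Real.abs_cos_le_one _)
    have h2 : |-(Real.sin α * Real.sin (s * L))| ≤ 1 := by
      rw [abs_neg, abs_mul]
      exact mul_le_one₀ (Real.abs_sin_le_one α) (abs_nonneg _) (Real.abs_sin_le_one _)
    have h3 := abs_sub_abs_le_abs_sub (f L) (Real.sin α * Real.cos (s * L))
    have h4 := abs_sub_abs_le_abs_sub (g L / s) (-(Real.sin α * Real.sin (s * L)))
    linarith [hf L hLm]
  refine ⟨fun x hx => (hf x hx).trans (by gcongr; linarith), fun t ht => ?_⟩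
  have hI' := hr.abs_duhamel_le hd.right hL hs hs' hdata' 0 t ht
  have e : z t - Real.sin α * Real.cos (s * (L + t)) =
      ((f L - Real.sin α * Real.cos (s * L)) * Real.cos (s * t)
        + (g L / s - -(Real.sin α * Real.sin (s * L))) * Real.sin (s * t))
      - duhamel p' τ' s 0 t z / s := by
    rw [hr.eq_of_zero_phase hd.right hs0.ne' ht, sh.right_value, sh.right_slope, mul_add,
      Real.cos_add]
    ring
  rw [e]
  refine (abs_sub _ _).trans ((add_le_add (abs_mul_cos_add_mul_sin_le _ _ _) le_rfl).trans ?_)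
  have h5 : |duhamel p' τ' s 0 t z / s| ≤ B₂ / s := by
    rw [abs_div, abs_of_pos hs0]
    gcongr
  have h6 : (2 * B₁ + B₂) / s = B₁ / s + B₁ / s + B₂ / s := by ring
  rw [h6]
  exact add_le_add (add_le_add (hf L hLm) hg) h5

/-- The characteristic equation. Divided by `s`, the boundary condition at `π` has leading term
`-sin α sin β sin (π s)`; all the rest is `1 / s` times a bounded Lipschitz function of `s`. -/
lemma exists_isEigenvalue_sq_iff (hd : HalfData q Δ K p τ p' τ') (hδ : δ ≠ 0)
    (hα : Real.sin α ≠ 0) (hβ : Real.sin β ≠ 0) (hS : 1 ≤ S)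
    (hS' : 4 * (K * (Real.pi / 2)) ≤ S) :
    ∃ R, BddLip S R ∧ ∀ s, S ≤ s →
      (IsEigenvalue q Δ α β δ (s ^ 2) ↔ Real.sin (Real.pi * s) = R s / s) := by
  have hL : (0 : ℝ) ≤ Real.pi / 2 := by positivity
  have hLm := right_mem_Icc.2 hL
  have hex : ∀ s, ∃ f g z w, S ≤ s → Shooting p τ p' τ' α s f g z w := fun s => by
    by_cases hs : S ≤ s
    · obtain ⟨f, g, z, w, h⟩ := hd.exists_shooting α (hS.trans hs) (hS'.trans hs)
      exact ⟨f, g, z, w, fun _ => h⟩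
    · exact ⟨0, 0, 0, 0, fun h => absurd h hs⟩
  choose f g z w sh using hex
  have hl : ∀ s, S ≤ s → IsHalfSolution (Real.pi / 2) p τ s (f s) (g s) := fun s hs =>
    (sh s hs).isHalfSolution_left
  have hr : ∀ s, S ≤ s → IsHalfSolution (Real.pi / 2) p' τ' s (z s) (w s) := fun s hs =>
    (sh s hs).isHalfSolution_right
  have hf0 : BddLip S fun s => f s 0 :=
    (BddLip.const S (Real.sin α)).congr fun s hs => (sh s hs).left_value
  have hg0 : BddLip S fun s => g s 0 / s :=
    ((BddLip.inv hS).const_mul (-Real.cos α)).congr fun s hs => by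
      rw [(sh s hs).left_slope, div_eq_mul_inv]
  obtain ⟨hfL, hgL⟩ := BddLip.solution_right hd.left hL hS hS' hl hf0 hg0
  have hz0 : BddLip S fun s => z s 0 := hfL.congr fun s hs => (sh s hs).right_value
  have hw0 : BddLip S fun s => w s 0 / s := hgL.congr fun s hs => by
    simp only [(sh s hs).right_slope]
  obtain ⟨hzL, -⟩ := BddLip.solution_right hd.right hL hS hS' hr hz0 hw0
  have hI₁ := BddLip.duhamel hd.left hL hS hS' hl hf0 hg0 0
  have hI₂ := BddLip.duhamel hd.left hL hS hS' hl hf0 hg0 (Real.pi / 2)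
  have hI₃ := BddLip.duhamel hd.right hL hS hS' hr hz0 hw0 (Real.pi / 2)
  have hsin := BddLip.sin_mul S (Real.pi / 2)
  have hcos := BddLip.cos_mul S (Real.pi / 2)
  refine ⟨_, (((((((BddLip.const S (Real.cos α)).mul hsin).add hI₁).mul hsin).sub
    ((((BddLip.const S (Real.cos α)).mul hcos).add hI₂).mul hcos)).sub hI₃).const_mul
      (Real.sin β)).add (hzL.const_mul (Real.cos β)) |>.const_mul
        (Real.sin α * Real.sin β)⁻¹, fun s hs => ?_⟩
  have hs1 := hS.trans hs
  have hs0 : 0 < s := by linarith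
  have hchar : IsEigenvalue q Δ α β δ (s ^ 2) ↔
      z s (Real.pi / 2) * Real.cos β + w s (Real.pi / 2) * Real.sin β = 0 := by
    constructor
    · rintro ⟨y, hy⟩
      obtain ⟨c, -, -, -, h⟩ := hy.eq_smul_shooting hd hδ hα hs1 (hS'.trans hs) (sh s hs)
      exact h
    · exact fun h => ⟨_, ((sh s hs).isEigenfunction hd hδ hα hs0 h rfl).1⟩
  have hw := (hr s hs).deriv_eq hd.right hs0.ne' hLm
  rw [(sh s hs).right_value, (sh s hs).right_slope, (hl s hs).deriv_eq hd.left hs0.ne' hLm,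
    (hl s hs).eq_of_zero_phase hd.left hs0.ne' hLm, (sh s hs).left_value, (sh s hs).left_slope,
    div_eq_iff hs0.ne'] at hw
  have hsin2 : Real.sin (Real.pi * s) =
      2 * Real.sin (s * (Real.pi / 2)) * Real.cos (s * (Real.pi / 2)) := by
    rw [← Real.sin_two_mul]
    congr 1
    ring
  have hw' : w s (Real.pi / 2) =
      -(Real.sin α * (2 * Real.sin (s * (Real.pi / 2)) * Real.cos (s * (Real.pi / 2)) * s)) +
      ((Real.cos α * Real.sin (s * (Real.pi / 2)) + duhamel p τ s 0 (Real.pi / 2) (f s))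
          * Real.sin (s * (Real.pi / 2))
        - (Real.cos α * Real.cos (s * (Real.pi / 2))
          + duhamel p τ s (Real.pi / 2) (Real.pi / 2) (f s)) * Real.cos (s * (Real.pi / 2))
        - duhamel p' τ' s (Real.pi / 2) (Real.pi / 2) (z s)) := by
    rw [hw]
    field_simp
    ring
  rw [hchar, hw', hsin2, eq_div_iff hs0.ne', eq_inv_mul_iff_mul_eq₀ (mul_ne_zero hα hβ)]
  constructor <;> intro h <;> linear_combination -h

/-- Replacing `s^(-2/3)` by `n^(-2/3)` costs only `O(1/n)`, as `|s^(2/3) - n^(2/3)| ≤ 1` and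
`(s n)^(2/3) ≥ (s n)^(1/2) ≥ n / 2`. -/
lemma abs_inv_rpow_sub_inv_rpow_le {s n : ℝ} (hs : 1 ≤ s) (hn : 1 ≤ n) (h : |s - n| ≤ 1 / 2) :
    |1 / s ^ (2 / 3 : ℝ) - 1 / n ^ (2 / 3 : ℝ)| ≤ 2 / n := by
  have hs0 : 0 < s := by linarith
  have hn0 : 0 < n := by linarith
  rw [abs_le] at h
  have hstep : ∀ a b : ℝ, 0 ≤ a → 0 ≤ b → b ≤ a + 1 →
      b ^ (2 / 3 : ℝ) ≤ a ^ (2 / 3 : ℝ) + 1 := fun a b ha hb hab =>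
    calc b ^ (2 / 3 : ℝ) ≤ (a + 1) ^ (2 / 3 : ℝ) := by gcongr
      _ ≤ a ^ (2 / 3 : ℝ) + 1 ^ (2 / 3 : ℝ) :=
        Real.rpow_add_le_add_rpow ha zero_le_one (by norm_num) (by norm_num)
      _ = _ := by rw [Real.one_rpow]
  have h1 := hstep s n hs0.le hn0.le (by linarith)
  have h2 := hstep n s hn0.le hs0.le (by linarith)
  have hpos : 0 < s ^ (2 / 3 : ℝ) * n ^ (2 / 3 : ℝ) := by positivity
  have h3 : n / 2 ≤ s ^ (2 / 3 : ℝ) * n ^ (2 / 3 : ℝ) := by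
    rw [← Real.mul_rpow hs0.le hn0.le]
    have h4 : (s * n) ^ (1 / 2 : ℝ) ≤ (s * n) ^ (2 / 3 : ℝ) :=
      Real.rpow_le_rpow_of_exponent_le (one_le_mul_of_one_le_of_one_le hs hn) (by norm_num)
    refine le_trans ?_ h4
    rw [← Real.sqrt_eq_rpow]
    apply Real.le_sqrt_of_sq_le
    nlinarith
  have e : 1 / s ^ (2 / 3 : ℝ) - 1 / n ^ (2 / 3 : ℝ) =
      (n ^ (2 / 3 : ℝ) - s ^ (2 / 3 : ℝ)) / (s ^ (2 / 3 : ℝ) * n ^ (2 / 3 : ℝ)) := by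
    field_simp
  rw [e, abs_div, abs_of_pos hpos]
  calc _ ≤ 1 / (n / 2) := by
        gcongr
        rw [abs_le]
        constructor <;> linarith
    _ = 2 / n := by field_simp

lemma one_div_le_rpow_neg_third {n : ℝ} (hn : 1 ≤ n) : 1 / n ≤ n ^ (-(1 / 3) : ℝ) := by
  rw [one_div, ← Real.rpow_neg_one]
  exact Real.rpow_le_rpow_of_exponent_le hn (by norm_num)

end

end RetardedBVP

open RetardedBVP in
theorem theorem3 (q Δ : ℝ → ℝ) (α β δ : ℝ) (hqΔ : RetardedBVP.Admissible q Δ)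
    (hδ : δ ≠ 0) (hα : Real.sin α ≠ 0) (hβ : Real.sin β ≠ 0) :
    (∀ ε : ℝ, 0 < ε → ε < 1 → ∃ N : ℕ, ∀ n : ℕ, N ≤ n →
      ∃! lam : ℝ, RetardedBVP.IsEigenvalue q Δ α β δ lam ∧ 0 < lam ∧
        |Real.sqrt lam - (n : ℝ)| < ε) ∧
    ∃ (C : ℝ) (N : ℕ), ∀ n : ℕ, N ≤ n → ∀ s : ℝ, 0 < s →
      RetardedBVP.IsEigenvalue q Δ α β δ (s ^ 2) → |s - (n : ℝ)| < 1 / 2 →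
      |s - (n : ℝ)| ≤ C * (n : ℝ) ^ (-(1 / 3) : ℝ) ∧
      ∃ u : ℝ → ℝ, RetardedBVP.IsEigenfunction q Δ α β δ (s ^ 2) u ∧
        u 0 = Real.sin α ∧ RetardedBVP.D u 0 = -Real.cos α ∧
        (∀ v : ℝ → ℝ, RetardedBVP.IsEigenfunction q Δ α β δ (s ^ 2) v →
          ∃ c : ℝ, c ≠ 0 ∧ ∀ x ∈ RetardedBVP.dom, v x = c * u x) ∧
        (∀ x ∈ Set.Ico 0 (Real.pi / 2),
          |u x - Real.sin α * Real.cos (n * x)| ≤ C * (n : ℝ) ^ (-(1 / 3) : ℝ)) ∧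
        (∀ x ∈ Set.Ioc (Real.pi / 2) Real.pi,
          |u x - Real.sin α / (δ * (n : ℝ) ^ (2 / 3 : ℝ)) * Real.cos (n * x)|
            ≤ C * (1 / (n : ℝ))) := by
  obtain ⟨K, p, τ, p', τ', hd⟩ := hqΔ.exists_halfData
  set S : ℝ := max 1 (4 * (K * (Real.pi / 2))) with hSdef
  have hS : 1 ≤ S := le_max_left _ _
  have hS' : 4 * (K * (Real.pi / 2)) ≤ S := le_max_right _ _
  have hL : (0 : ℝ) < Real.pi / 2 := by positivity
  obtain ⟨R, hR, hiff⟩ := exists_isEigenvalue_sq_iff hd hδ hα hβ hS hS'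
  have hlarge : ∀ n : ℕ, ⌈S + 1⌉₊ ≤ n → ∀ s : ℝ, |s - n| < 1 → S ≤ s := fun n hn s hs => by
    rw [Nat.ceil_le] at hn
    rw [abs_lt] at hs
    linarith
  constructor
  · intro ε hε hε1
    obtain ⟨N, hN⟩ := hR.existsUnique_sin_eq hS hε hε1
    refine ⟨max N ⌈S + 1⌉₊, fun n hn => ?_⟩
    obtain ⟨s, ⟨hs, hsε, hse⟩, huniq⟩ := hN n ((le_max_left _ _).trans hn)
    have hs0 : 0 < s := by linarith
    refine ⟨s ^ 2, ⟨(hiff s hs).2 hse, by positivity, by rwa [Real.sqrt_sq hs0.le]⟩, ?_⟩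
    rintro lam ⟨hlam, hpos, hlamε⟩
    have hr := hlarge n ((le_max_right _ _).trans hn) _ (hlamε.trans hε1)
    rw [← Real.sq_sqrt hpos.le, hiff _ hr] at hlam
    rw [← huniq _ ⟨hr, hlamε, hlam⟩, Real.sq_sqrt hpos.le]
  · obtain ⟨B₀, hB₀, hroot⟩ := hR.exists_abs_sub_nat_le hS
    obtain ⟨B, hB, hasymp⟩ := Shooting.exists_bound hd α
    set C₁ := 2 * B + 4 * B₀ with hC₁
    set C := (C₁ + B₀) + (C₁ + 2) / |δ| with hC
    have hδ' : 0 < |δ| := abs_pos.2 hδ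
    have hC₁0 : 0 ≤ C₁ := by positivity
    have hC0 : 0 ≤ C := by positivity
    have hCδ : (C₁ + 2) / |δ| ≤ C := by linarith
    have hC₂ : C₁ + B₀ ≤ C := by
      have : 0 ≤ (C₁ + 2) / |δ| := by positivity
      linarith
    refine ⟨C, ⌈S + 1⌉₊, fun n hn s hs0 hev hsn => ?_⟩
    have hsS := hlarge n hn s (by linarith)
    have hs1 := hS.trans hsS
    have hn1 : (1 : ℝ) ≤ n := by
      rw [Nat.ceil_le] at hn
      linarith
    have hn0 : (0 : ℝ) < n := by linarith
    have hthird : ∀ x : ℝ, x ≤ C / n → x ≤ C * (n : ℝ) ^ (-(1 / 3) : ℝ) := fun x hx => by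
      rw [div_eq_mul_one_div] at hx
      exact hx.trans (by gcongr; exact one_div_le_rpow_neg_third hn1)
    have hsn' : |s - n| ≤ B₀ / n :=
      hroot n (by exact_mod_cast hn1) s hsS hsn ((hiff s hsS).1 hev)
    have hsB : B / s ≤ 2 * B / n := by
      rw [abs_lt] at hsn
      rw [div_le_div_iff₀ hs0 hn0]
      nlinarith
    have hcos : ∀ x : ℝ, 0 ≤ x → x ≤ Real.pi →
        |Real.sin α * Real.cos (s * x) - Real.sin α * Real.cos (n * x)| ≤ 4 * B₀ / n := by
      intro x hx0 hx
      rw [← mul_sub, abs_mul]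
      calc _ ≤ 1 * (|s - n| * x) := by
            gcongr
            · exact Real.abs_sin_le_one α
            · refine (abs_cos_sub_cos_le _ _).trans_eq ?_
              rw [← sub_mul, abs_mul, abs_of_nonneg hx0]
        _ ≤ 1 * (B₀ / n * 4) := by
            gcongr
            exact hx.trans Real.pi_le_four
        _ = _ := by ring
    obtain ⟨f, g, z, w, sh⟩ := hd.exists_shooting α hs1 (hS'.trans hsS)
    obtain ⟨hf, hz⟩ := hasymp s f g z w hs1 (hS'.trans hsS) sh
    obtain ⟨y, hy⟩ := hev
    obtain ⟨-, -, -, -, hchar⟩ := hy.eq_smul_shooting hd hδ hα hs1 (hS'.trans hsS) sh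
    obtain ⟨hu, hu'⟩ := sh.isEigenfunction hd hδ hα hs0 hchar rfl
    refine ⟨hthird _ (hsn'.trans (by gcongr; linarith)), _, hu, ?_, hu', ?_, ?_, ?_⟩
    · rw [glue_left _ _ hL, sh.left_value]
    · intro v hv
      obtain ⟨c, hc, hl, hr, -⟩ := hv.eq_smul_shooting hd hδ hα hs1 (hS'.trans hsS) sh
      refine ⟨c, hc, ?_⟩
      rintro x (hx | hx)
      · rw [glue_left _ _ hx.2, hl x hx]
      · have := hr (x - Real.pi / 2) ⟨by linarith [hx.1], by linarith [hx.2]⟩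
        rw [add_sub_cancel] at this
        rw [glue_right _ _ hx.1.le, this]
        ring
    · intro x hx
      rw [glue_left _ _ hx.2]
      apply hthird
      refine (abs_sub_le _ (Real.sin α * Real.cos (s * x)) _).trans ?_
      have h1 := hf x (Set.Ico_subset_Icc_self hx)
      have h2 := hcos x hx.1 (by linarith [hx.2])
      calc _ ≤ 2 * B / n + 4 * B₀ / n := add_le_add (h1.trans hsB) h2
        _ = C₁ / n := by ring
        _ ≤ C / n := by gcongr; linarith
    · intro x hx
      have h1 := hz (x - Real.pi / 2) ⟨by linarith [hx.1], by linarith [hx.2]⟩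
      have h2 := hcos x (by linarith [hx.1]) hx.2
      rw [add_sub_cancel] at h1
      have h3 : |z (x - Real.pi / 2) - Real.sin α * Real.cos (n * x)| ≤ C₁ / n := by
        refine (abs_sub_le _ (Real.sin α * Real.cos (s * x)) _).trans ?_
        calc _ ≤ 2 * B / n + 4 * B₀ / n := add_le_add (h1.trans hsB) h2
          _ = C₁ / n := by ring
      have h4 := abs_inv_rpow_sub_inv_rpow_le hs1 hn1 hsn.le
      have hs23 : 1 ≤ s ^ (2 / 3 : ℝ) := Real.one_le_rpow hs1 (by norm_num)
      have hs23' : 1 / s ^ (2 / 3 : ℝ) ≤ 1 := (div_le_one (by linarith)).2 hs23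
      have hn23 : (n : ℝ) ^ (2 / 3 : ℝ) ≠ 0 := by positivity
      rw [glue_right _ _ hx.1.le, cbrt_sq hs0]
      have e : z (x - Real.pi / 2) / (s ^ (2 / 3 : ℝ) * δ)
          - Real.sin α / (δ * (n : ℝ) ^ (2 / 3 : ℝ)) * Real.cos (n * x) =
          ((z (x - Real.pi / 2) - Real.sin α * Real.cos (n * x)) * (1 / s ^ (2 / 3 : ℝ))
            + Real.sin α * Real.cos (n * x)
              * (1 / s ^ (2 / 3 : ℝ) - 1 / (n : ℝ) ^ (2 / 3 : ℝ))) / δ := by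
        field_simp
        ring
      have h5 : |Real.sin α * Real.cos (n * x)| ≤ 1 := by
        rw [abs_mul]
        exact mul_le_one₀ (Real.abs_sin_le_one α) (abs_nonneg _) (Real.abs_cos_le_one _)
      rw [e, abs_div]
      calc _ ≤ (C₁ / n * 1 + 1 * (2 / n)) / |δ| := by
            gcongr
            refine (abs_add_le _ _).trans ?_
            rw [abs_mul, abs_mul, abs_of_nonneg (by positivity : 0 ≤ 1 / s ^ (2 / 3 : ℝ))]
            gcongr
        _ = (C₁ + 2) / |δ| * (1 / n) := by ring
        _ ≤ C * (1 / n) := by gcongr
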